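/- Let $p$ be a prime and let $G$ be a uniform pro-$p$ group, that is, a pro-$p$ group which for some $l$ is topologically generated by $l$ elements and satisfies $G^{p^n}/G^{p^{n+1}}\cong(\mathbb{Z}/p)^l$ for all $n\ge 0$, where $G^{p^n}$ is the closed subgroup generated by the $p^n$-th powers. Put $G^{(n)}=G/G^{p^n}$ and $\Lambda=\mathbb{Z}_p[[G]]=\varprojlim_n\mathbb{Z}_p[G^{(n)}]$, with projections $\pi_n:\Lambda\to\mathbb{Z}_p[G^{(n)}]$; modules are left modules. Let $X$ be a finite graph (loops and multiple edges allowed) with an orientation of its edges, and let $\alpha$ be a voltage assignment which maps the oriented edges to $G$; it is extended to the reversed edges by $\alpha(\bar e)=\alpha(e)^{-1}$. Let $X_n$ be the derived graph of the induced assignment with values in $G^{(n)}$: its vertices are the pairs $(v,g)$ with $v\in V(X)$, $g\in G^{(n)}$; each edge $e$ from $v$ to $w$ gives edges from $(v,g)$ to $(w,g\alpha(e))$; and $h(v,g)=(v,hg)$. Let $X_\infty$ be the derived graph of $\alpha$ itself. Assume that every $X_n$ is connected. For a graph $Y$ let $\mathrm{Div}^0(Y)$ be the $\mathbb{Z}_p$-module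 of divisors of degree zero with coefficients in $\mathbb{Z}_p$, $\mathrm{Pr}(Y)$ its submodule spanned by the divisors $\sum_{e:v\to w}(v-w)$, $v\in V(Y)$ (the sum over all directed edges $e$ starting at $v$), and $J(Y)=\mathrm{Div}^0(Y)/\mathrm{Pr}(Y)$. Put $J_\infty=\varprojlim_nJ(X_n)$. Let $D$ be the diagonal matrix whose entry at $v$ is the number of directed edges starting at $v$, and let $A_\alpha$ be the matrix over $\Lambda$ whose $(v,w)$-entry is $\sum_e\alpha(e)$ over all directed edges $e$ from $v$ to $w$ (a loop counts as two directed edges). For a finite group $H$ let $\mathrm{Nrd}$ be the reduced norm with values in the center $Z(\mathbb{Q}_p[H])$, and let $I(\mathbb{Z}_p[H])\subseteq Z(\mathbb{Q}_p[H])$ be the subring which is generated as a $Z(\mathbb{Z}_p[H])$-module by the reduced norms of all square matrices over $\mathbb{Z}_p[H]$; put $I(\Lambda)=\varprojlim_nI(\mathbb{Z}_p[G^{(n)}])$. A $b\times a$ matrix $h$ over $\Lambda$ describes the $\Lambda$-linear map $\Lambda^a\to\Lambda^b$ that sends the basis vectors to the columns of $h$. For a square matrix $M$ over $\Lambda$ let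 $\mathrm{Nrd}(M)\in I(\Lambda)$ be the limit of the reduced norms of the endomorphisms of the free left modules $\mathbb{Q}_p[G^{(n)}]^b$ that are described in this way by the matrices $\pi_n(M)$. For a $\Lambda$-module $N$ let $\mathrm{Fitt}_\Lambda(N)$ be the ideal of $I(\Lambda)$ generated by the $\mathrm{Nrd}(H)$, where $H$ runs through all $b\times b$ submatrices of all matrices $h$ of finite presentations $\Lambda^a\to\Lambda^b\to N\to0$. Then \[\mathrm{Fitt}_\Lambda(J_\infty)\cdot\langle\mathrm{Nrd}(g-1)\mid g\in G\rangle_{I(\Lambda)}\subseteq\langle\mathrm{Nrd}(D-A_\alpha^t)\rangle_{I(\Lambda)}.\] The same inclusion holds with $J_\infty$ replaced by $\Lambda\otimes_{\mathbb{Z}_p[G]}J(X_\infty)$. -/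

import Mathlib

set_option linter.unusedSectionVars false

namespace NCIwasawa

section Wedderburn


/-- A surjection from a product of matrix algebras onto a matrix algebra is, up to conjugation, one of
the projections; so block determinants computed through it agree with those of a projection. -/
theorem exists_component {K A : Type*} [Field K] [Ring A] [Algebra K A] {n : ℕ} {d : Fin n → ℕ} (hd : ∀ i, NeZero (d i))
    (e : A ≃ₐ[K] Π i, Matrix (Fin (d i)) (Fin (d i)) K) {m : ℕ} [NeZero m]
    (φ : A →ₐ[K] Matrix (Fin m) (Fin m) K) (hφ : Function.Surjective φ) :
    ∃ (i : Fin n) (P : Matrix (Fin m) (Fin (d i)) K) (Q : Matrix (Fin (d i)) (Fin m) K),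
      P * Q = 1 ∧ Q * P = 1 ∧ ∀ a, φ a = P * e a i * Q := by
  classical
  set ψ : (Π i, Matrix (Fin (d i)) (Fin (d i)) K) →ₐ[K] Matrix (Fin m) (Fin m) K :=
    φ.comp e.symm.toAlgHom with hψ
  have hψs : Function.Surjective ψ := hφ.comp e.symm.surjective
  obtain ⟨i, hi⟩ : ∃ i, ψ (Pi.single i 1) ≠ 0 := by
    by_contra! h
    have h1 : ψ 1 = 0 := by
      have : (1 : Π i, Matrix (Fin (d i)) (Fin (d i)) K) = ∑ i, Pi.single i 1 := by
        exact (Finset.univ_sum_single (1 : Π i, Matrix (Fin (d i)) (Fin (d i)) K)).symm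
      rw [this, map_sum]
      exact Finset.sum_eq_zero fun i _ => h i
    rw [map_one] at h1
    exact one_ne_zero h1
  have hcent : ψ (Pi.single i 1) ∈ Subalgebra.center K (Matrix (Fin m) (Fin m) K) := by
    rw [Subalgebra.mem_center_iff]
    intro b
    obtain ⟨x, rfl⟩ := hψs b
    rw [← map_mul, ← map_mul]
    congr 1
    funext j
    by_cases hj : j = i
    · subst hj; simp
    · simp [Pi.single_eq_of_ne hj]
  rw [Algebra.IsCentral.center_eq_bot, Algebra.mem_bot] at hcent
  obtain ⟨c, hc⟩ := hcent
  have hidem : ψ (Pi.single i 1) * ψ (Pi.single i 1) = ψ (Pi.single i 1) := by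
    rw [← map_mul, ← Pi.single_mul, one_mul]
  have hc1 : ψ (Pi.single i 1) = 1 := by
    rw [← hc, ← map_mul] at hidem
    have h2 : c * c = c := (algebraMap K (Matrix (Fin m) (Fin m) K)).injective hidem
    have hc0 : c ≠ 0 := by
      rintro rfl
      exact hi (by rw [← hc, map_zero])
    have : c = 1 := mul_left_cancel₀ hc0 (by rw [h2, mul_one])
    rw [← hc, this, map_one]
  let f : Matrix (Fin (d i)) (Fin (d i)) K →ₐ[K] Matrix (Fin m) (Fin m) K :=
    AlgHom.ofLinearMap (ψ.toLinearMap ∘ₗ LinearMap.single K (fun i => Matrix (Fin (d i)) (Fin (d i)) K) i) (by simpa using hc1)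
      (fun x y => by simp [Pi.single_mul])
  have hf : ∀ x, ψ x = f (x i) := by
    intro x
    have : ψ x = ψ (x * Pi.single i 1) := by rw [map_mul, hc1, mul_one]
    rw [this]
    have h2 : x * Pi.single i 1 = Pi.single i (x i) := by
      funext j
      by_cases hj : j = i
      · subst hj; simp
      · simp [Pi.single_eq_of_ne hj]
    rw [h2]
    rfl
  have hfs : Function.Surjective f := fun b => by
    obtain ⟨x, rfl⟩ := hψs b
    exact ⟨x i, (hf x).symm⟩
  have := hd i
  have hfi : Function.Injective f := f.toRingHom.injective
  let F : Matrix (Fin (d i)) (Fin (d i)) K ≃ₐ[K] Matrix (Fin m) (Fin m) K :=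
    AlgEquiv.ofBijective f ⟨hfi, hfs⟩
  obtain ⟨T, hT⟩ := AlgEquiv.eq_linearEquivConjAlgEquiv
    ((Matrix.toLinAlgEquiv' (R := K) (n := Fin (d i))).symm.trans
      (F.trans (Matrix.toLinAlgEquiv' (R := K) (n := Fin m))))
  refine ⟨i, LinearMap.toMatrix' T.toLinearMap, LinearMap.toMatrix' T.symm.toLinearMap, ?_, ?_, ?_⟩
  · rw [← LinearMap.toMatrix'_comp]; simp
  · rw [← LinearMap.toMatrix'_comp]; simp
  · intro a
    have h3 : φ a = F (e a i) := by
      have := hf (e a)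
      rw [hψ] at this
      exact (by simpa using this : φ a = f (e a i))
    have h4 := congrArg (fun g => g (Matrix.toLin' (e a i))) hT
    have h5 : Matrix.toLin' (F (e a i)) = T.toLinearMap ∘ₗ Matrix.toLin' (e a i) ∘ₗ T.symm.toLinearMap := by
      rw [LinearEquiv.conjAlgEquiv_apply] at h4
      rw [← h4]
      change _ = Matrix.toLin' (F (LinearMap.toMatrix' (Matrix.toLin' (e a i))))
      rw [LinearMap.toMatrix'_toLin']
    rw [h3]
    apply Matrix.toLin'.injective
    rw [h5]
    simp [Matrix.toLin'_mul, LinearMap.comp_assoc]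

/-- The block determinant of a square matrix over `A` along a map `A → Mat_d(K)`. -/
noncomputable def blockDet {K A ι : Type*} [Field K] [Fintype ι] [DecidableEq ι] {m : ℕ}
    (φ : A → Matrix (Fin m) (Fin m) K) (M : Matrix ι ι A) : K :=
  (Matrix.comp ι ι (Fin m) (Fin m) K (M.map φ)).det

theorem blockDet_conj {K A ι : Type*} [Field K] [Fintype ι] [DecidableEq ι] {m k : ℕ}
    (φ : A → Matrix (Fin m) (Fin m) K) (ψ : A → Matrix (Fin k) (Fin k) K)
    (P : Matrix (Fin m) (Fin k) K) (Q : Matrix (Fin k) (Fin m) K)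
    (hPQ : P * Q = 1) (hQP : Q * P = 1) (h : ∀ a, φ a = P * ψ a * Q) (M : Matrix ι ι A) :
    blockDet φ M = blockDet ψ M := by
  have key : Matrix.comp ι ι (Fin m) (Fin m) K (M.map φ) =
      Matrix.kroneckerMap (· * ·) (1 : Matrix ι ι K) P *
        Matrix.comp ι ι (Fin k) (Fin k) K (M.map ψ) *
        Matrix.kroneckerMap (· * ·) (1 : Matrix ι ι K) Q := by
    ext ⟨i, a⟩ ⟨j, b⟩
    simp [Matrix.mul_apply, h, Fintype.sum_prod_type, Matrix.one_apply, Finset.sum_mul]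
  unfold blockDet
  rw [key]
  apply Matrix.det_conj_of_mul_eq_one
  · rw [← Matrix.mul_kronecker_mul, hPQ]; simp
  · rw [← Matrix.mul_kronecker_mul, hQP]; simp

end Wedderburn

section ReducedNorm

variable (F H : Type*) [Field F] [CharZero F] [Group H] [Finite H]

theorem exists_wedderburn :
    ∃ (n : ℕ) (d : Fin n → ℕ), (∀ i, NeZero (d i)) ∧
      Nonempty (MonoidAlgebra (AlgebraicClosure F) H ≃ₐ[AlgebraicClosure F]
        Π i, Matrix (Fin (d i)) (Fin (d i)) (AlgebraicClosure F)) := by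
  have : NeZero (Nat.card H : AlgebraicClosure F) :=
    ⟨Nat.cast_ne_zero.mpr Nat.card_pos.ne'⟩
  have : Module.Finite (AlgebraicClosure F) (MonoidAlgebra (AlgebraicClosure F) H) :=
    inferInstance
  exact IsSemisimpleRing.exists_algEquiv_pi_matrix_of_isAlgClosed _ _

/-- The number of simple components of `F̄[H]`. -/
noncomputable def numComp : ℕ := (exists_wedderburn F H).choose

/-- The degrees of the simple components of `F̄[H]`. -/
noncomputable def degComp : Fin (numComp F H) → ℕ := (exists_wedderburn F H).choose_spec.choose

theorem degComp_neZero (i : Fin (numComp F H)) : NeZero (degComp F H i) :=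
  (exists_wedderburn F H).choose_spec.choose_spec.1 i

/-- A Wedderburn decomposition `F̄[H] ≃ ∏ᵢ Mat_{dᵢ}(F̄)`. -/
noncomputable def wedderburn :
    MonoidAlgebra (AlgebraicClosure F) H ≃ₐ[AlgebraicClosure F]
      Π i, Matrix (Fin (degComp F H i)) (Fin (degComp F H i)) (AlgebraicClosure F) :=
  (exists_wedderburn F H).choose_spec.choose_spec.2.some

variable {F H} {ι : Type*} [Fintype ι] [DecidableEq ι]

/-- The reduced norm `Mat_b(F̄[H]) → F̄[H]`: componentwise the determinant, where
`F̄ ⊆ Mat_{dᵢ}(F̄)` as the scalar matrices. -/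
noncomputable def nrdClosure (M : Matrix ι ι (MonoidAlgebra (AlgebraicClosure F) H)) :
    MonoidAlgebra (AlgebraicClosure F) H :=
  (wedderburn F H).symm fun i =>
    algebraMap (AlgebraicClosure F) _ (blockDet (fun a => wedderburn F H a i) M)

theorem wedderburn_nrdClosure (M : Matrix ι ι (MonoidAlgebra (AlgebraicClosure F) H))
    (i : Fin (numComp F H)) :
    wedderburn F H (nrdClosure M) i =
      algebraMap (AlgebraicClosure F) _ (blockDet (fun a => wedderburn F H a i) M) := by
  simp [nrdClosure]

/-- `ρ(Nrd(M)) = det(ρ(M)) · I_d` for every absolutely irreducible matrix representation `ρ`. -/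
theorem apply_nrdClosure {m : ℕ} [NeZero m]
    (φ : MonoidAlgebra (AlgebraicClosure F) H →ₐ[AlgebraicClosure F]
      Matrix (Fin m) (Fin m) (AlgebraicClosure F)) (hφ : Function.Surjective φ)
    (M : Matrix ι ι (MonoidAlgebra (AlgebraicClosure F) H)) :
    φ (nrdClosure M) = algebraMap (AlgebraicClosure F) _ (blockDet φ M) := by
  obtain ⟨i, P, Q, hPQ, hQP, h⟩ :=
    exists_component (degComp_neZero F H) (wedderburn F H) φ hφ
  rw [blockDet_conj φ (fun a => wedderburn F H a i) P Q hPQ hQP h, h, wedderburn_nrdClosure]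
  rw [Algebra.algebraMap_eq_smul_one, Algebra.algebraMap_eq_smul_one, Matrix.mul_smul,
    Matrix.smul_mul, Matrix.mul_one, hPQ]

theorem wedderburn_apply_surjective (i : Fin (numComp F H)) :
    Function.Surjective fun a => wedderburn F H a i :=
  (Function.surjective_eval i).comp (wedderburn F H).surjective

/-- The inclusion `F[H] → F̄[H]`. -/
noncomputable def toClosure : MonoidAlgebra F H →+* MonoidAlgebra (AlgebraicClosure F) H :=
  MonoidAlgebra.mapRingHom H (algebraMap F (AlgebraicClosure F))

theorem toClosure_injective : Function.Injective (toClosure (F := F) (H := H)) := by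
  intro x y hxy
  ext h
  have := congrArg (fun z => z.coeff h) hxy
  simpa [toClosure] using this

theorem map_aut_nrdClosure (σ : AlgebraicClosure F ≃ₐ[F] AlgebraicClosure F)
    (M : Matrix ι ι (MonoidAlgebra (AlgebraicClosure F) H)) :
    MonoidAlgebra.mapRingHom H (σ : AlgebraicClosure F →+* AlgebraicClosure F) (nrdClosure M) =
      nrdClosure (M.map (MonoidAlgebra.mapRingHom H
        (σ : AlgebraicClosure F →+* AlgebraicClosure F))) := by
  set s := MonoidAlgebra.mapRingHom H (σ : AlgebraicClosure F →+* AlgebraicClosure F) with hs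
  have hssurj : Function.Surjective s := by
    intro y
    refine ⟨MonoidAlgebra.mapRingHom H (σ.symm : AlgebraicClosure F →+* AlgebraicClosure F) y, ?_⟩
    ext h
    simp [hs]
  apply (wedderburn F H).injective
  funext i
  rw [wedderburn_nrdClosure]
  have := degComp_neZero F H i
  let φ : MonoidAlgebra (AlgebraicClosure F) H →ₐ[AlgebraicClosure F]
      Matrix (Fin (degComp F H i)) (Fin (degComp F H i)) (AlgebraicClosure F) :=
    { (σ.symm : AlgebraicClosure F →+* AlgebraicClosure F).mapMatrix.comp
        ((Pi.evalRingHom (fun i => Matrix (Fin (degComp F H i)) (Fin (degComp F H i))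
          (AlgebraicClosure F)) i).comp ((wedderburn F H).toRingEquiv.toRingHom.comp s)) with
      commutes' := by
        intro c
        have h1 : s (algebraMap _ _ c) = algebraMap _ _ (σ c) := by
          simp [hs, MonoidAlgebra.coe_algebraMap]
        change (wedderburn F H (s (algebraMap _ _ c)) i).map σ.symm = _
        rw [h1, AlgEquiv.commutes]
        ext a b
        by_cases hab : a = b <;> simp [Matrix.algebraMap_matrix_apply, hab] }
  have hφ : ∀ a, φ a = (wedderburn F H (s a) i).map σ.symm := fun a => rfl
  have hφs : Function.Surjective φ := by
    intro X
    obtain ⟨y, hy⟩ := wedderburn_apply_surjective i (X.map σ)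
    obtain ⟨a, rfl⟩ := hssurj y
    refine ⟨a, ?_⟩
    rw [hφ]
    ext u v
    have := congrFun (congrFun hy u) v
    simp only [Matrix.map_apply] at this ⊢
    simp [this]
  have key := apply_nrdClosure φ hφs M
  have h2 : blockDet (fun a => wedderburn F H a i) (M.map s) = σ (blockDet φ M) := by
    unfold blockDet
    rw [AlgEquiv.map_det]
    congr 1
    ext ⟨u, a⟩ ⟨v, b⟩
    simp [hφ]
  rw [h2]
  rw [hφ] at key
  ext u v
  have := congrArg σ (congrFun (congrFun key u) v)
  simp only [Matrix.map_apply, AlgEquiv.apply_symm_apply] at this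
  rw [this]
  by_cases huv : u = v <;> simp [Matrix.algebraMap_matrix_apply, huv]

/-- The reduced norm of a matrix over `F[H]` lies in the center of `F[H]`. -/
theorem exists_nrd (M : Matrix ι ι (MonoidAlgebra F H)) :
    ∃ z : Subring.center (MonoidAlgebra F H),
      toClosure (z : MonoidAlgebra F H) = nrdClosure (M.map toClosure) := by
  have hfix : ∀ σ : AlgebraicClosure F ≃ₐ[F] AlgebraicClosure F, ∀ h : H,
      σ ((nrdClosure (M.map toClosure)).coeff h) = (nrdClosure (M.map toClosure)).coeff h := by
    intro σ h
    have h1 := map_aut_nrdClosure σ (M.map toClosure)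
    have h2 : (M.map toClosure).map (MonoidAlgebra.mapRingHom H
        (σ : AlgebraicClosure F →+* AlgebraicClosure F)) = M.map toClosure := by
      ext i j h
      simp [toClosure]
    rw [h2] at h1
    have := congrArg (fun z => z.coeff h) h1
    simpa using this
  have hex : ∀ h : H, ∃ c : F, algebraMap F (AlgebraicClosure F) c =
      (nrdClosure (M.map toClosure)).coeff h := fun h =>
    (InfiniteGalois.mem_range_algebraMap_iff_fixed _).mpr fun σ => hfix σ h
  choose c hc using hex
  let z : MonoidAlgebra F H := .ofCoeff (Finsupp.equivFunOnFinite.symm c)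
  have hz : toClosure z = nrdClosure (M.map toClosure) := by
    ext h
    simp [toClosure, z, hc]
  refine ⟨⟨z, ?_⟩, hz⟩
  rw [Subring.mem_center_iff]
  intro g
  apply toClosure_injective
  rw [map_mul, map_mul, hz]
  apply (wedderburn F H).injective
  funext i
  simp only [map_mul, Pi.mul_apply, wedderburn_nrdClosure]
  exact (Algebra.commutes _ _).symm

/-- The reduced norm `Nrd : Mat_b(F[H]) → Z(F[H])` for a finite group `H` and a field `F` of
characteristic zero. -/
noncomputable def nrd (M : Matrix ι ι (MonoidAlgebra F H)) : Subring.center (MonoidAlgebra F H) :=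
  (exists_nrd M).choose

theorem toClosure_nrd (M : Matrix ι ι (MonoidAlgebra F H)) :
    toClosure (nrd M : MonoidAlgebra F H) = nrdClosure (M.map toClosure) :=
  (exists_nrd M).choose_spec

theorem wedderburn_nrd (M : Matrix ι ι (MonoidAlgebra F H)) (i : Fin (numComp F H)) :
    wedderburn F H (toClosure (nrd M : MonoidAlgebra F H)) i =
      algebraMap (AlgebraicClosure F) _
        (blockDet (fun a => wedderburn F H (toClosure a) i) M) := by
  rw [toClosure_nrd, wedderburn_nrdClosure]
  rfl

theorem nrd_ext {x y : Subring.center (MonoidAlgebra F H)}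
    (h : ∀ i, wedderburn F H (toClosure (x : MonoidAlgebra F H)) i =
      wedderburn F H (toClosure (y : MonoidAlgebra F H)) i) : x = y :=
  Subtype.ext (toClosure_injective ((wedderburn F H).injective (funext h)))

theorem nrd_one : nrd (1 : Matrix ι ι (MonoidAlgebra F H)) = 1 := by
  apply nrd_ext
  intro i
  rw [wedderburn_nrd]
  have : Matrix.comp ι ι _ _ (AlgebraicClosure F)
      ((1 : Matrix ι ι (MonoidAlgebra F H)).map fun a => wedderburn F H (toClosure a) i) = 1 := by
    rw [Matrix.map_one _ (by simp) (by simp), Matrix.comp_one]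
  rw [blockDet, this]
  simp

/-- `Nrd(M) Nrd(N)` is the reduced norm of the block diagonal matrix. -/
theorem nrd_fromBlocks {κ : Type*} [Fintype κ] [DecidableEq κ]
    (M : Matrix ι ι (MonoidAlgebra F H)) (N : Matrix κ κ (MonoidAlgebra F H)) :
    nrd (Matrix.fromBlocks M 0 0 N) = nrd M * nrd N := by
  apply nrd_ext
  intro i
  rw [Subring.coe_mul, map_mul, map_mul, Pi.mul_apply]
  simp only [wedderburn_nrd]
  rw [← map_mul]
  congr 1
  unfold blockDet
  rw [← Matrix.det_fromBlocks_zero₂₁ _ 0, ← Matrix.det_reindex_self (Equiv.sumProdDistrib _ _ _)]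
  congr 1
  ext (⟨u, a⟩ | ⟨u, a⟩) (⟨v, b⟩ | ⟨v, b⟩) <;> simp [Matrix.comp_apply]

theorem nrd_reindex {κ : Type*} [Fintype κ] [DecidableEq κ] (e : ι ≃ κ)
    (M : Matrix ι ι (MonoidAlgebra F H)) :
    nrd (Matrix.reindex e e M) = nrd M := by
  apply nrd_ext
  intro i
  simp only [wedderburn_nrd]
  congr 1
  unfold blockDet
  rw [← Matrix.det_reindex_self (e.prodCongr (Equiv.refl (Fin (degComp F H i))))]
  congr 1

/-- Reduced norms are compatible with the projection to a quotient group. -/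
theorem nrd_mapDomain {H' : Type*} [Group H'] [Finite H'] (f : H →* H')
    (hf : Function.Surjective f) (M : Matrix ι ι (MonoidAlgebra F H)) :
    MonoidAlgebra.mapDomainRingHom F f (nrd M : MonoidAlgebra F H) =
      (nrd (M.map (MonoidAlgebra.mapDomainRingHom F f)) : MonoidAlgebra F H') := by
  apply toClosure_injective
  apply (wedderburn F H').injective
  funext i
  rw [wedderburn_nrd]
  have := degComp_neZero F H' i
  let g : MonoidAlgebra (AlgebraicClosure F) H →ₐ[AlgebraicClosure F]
      MonoidAlgebra (AlgebraicClosure F) H' :=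
    MonoidAlgebra.mapDomainAlgHom (AlgebraicClosure F) (AlgebraicClosure F) f
  have hg : Function.Surjective g := by
    intro y
    induction y using MonoidAlgebra.induction_linear with
    | zero => exact ⟨0, map_zero _⟩
    | add x y hx hy =>
      obtain ⟨a, rfl⟩ := hx
      obtain ⟨b, rfl⟩ := hy
      exact ⟨a + b, map_add _ _ _⟩
    | single h c =>
      obtain ⟨h, rfl⟩ := hf h
      exact ⟨MonoidAlgebra.single h c, by simp [g]⟩
  have hcomm : ∀ x : MonoidAlgebra F H,
      toClosure (MonoidAlgebra.mapDomainRingHom F f x) = g (toClosure x) := fun x =>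
    RingHom.congr_fun (MonoidAlgebra.mapRingHom_comp_mapDomainRingHom
      (algebraMap F (AlgebraicClosure F)) f) x
  let φ : MonoidAlgebra (AlgebraicClosure F) H →ₐ[AlgebraicClosure F]
      Matrix (Fin (degComp F H' i)) (Fin (degComp F H' i)) (AlgebraicClosure F) :=
    (Pi.evalAlgHom _ _ i).comp ((wedderburn F H').toAlgHom.comp g)
  have hφ : ∀ a, φ a = wedderburn F H' (g a) i := fun a => rfl
  have key := apply_nrdClosure φ ((wedderburn_apply_surjective i).comp hg) (M.map toClosure)
  rw [hcomm, toClosure_nrd, ← hφ, key]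
  congr 1
  unfold blockDet
  congr 2
  ext u v : 2
  rw [Matrix.map_apply, Matrix.map_apply, Matrix.map_apply, Matrix.map_apply, hφ, hcomm]

end ReducedNorm

section Uniform

/-- `G^{pⁿ}`: the closed subgroup generated by the `pⁿ`-th powers. -/
def powSubgroup (p : ℕ) (G : Type*) [Group G] [TopologicalSpace G] [IsTopologicalGroup G]
    (n : ℕ) : Subgroup G :=
  (Subgroup.closure (Set.range fun g : G => g ^ p ^ n)).topologicalClosure

instance powSubgroup_normal (p : ℕ) (G : Type*) [Group G] [TopologicalSpace G]
    [IsTopologicalGroup G] (n : ℕ) : (powSubgroup p G n).Normal := by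
  have : (Subgroup.closure (Set.range fun g : G => g ^ p ^ n)).Normal := by
    constructor
    intro x hx g
    induction hx using Subgroup.closure_induction with
    | mem x hx =>
      obtain ⟨y, rfl⟩ := hx
      exact Subgroup.subset_closure ⟨g * y * g⁻¹, conj_pow⟩
    | one => simp
    | mul x y _ _ hx hy => simpa using mul_mem hx hy
    | inv x _ hx => simpa [mul_assoc] using inv_mem hx
  exact Subgroup.is_normal_topologicalClosure _

theorem powSubgroup_succ_le (p : ℕ) (G : Type*) [Group G] [TopologicalSpace G]
    [IsTopologicalGroup G] (n : ℕ) : powSubgroup p G (n + 1) ≤ powSubgroup p G n := by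
  apply Subgroup.topologicalClosure_mono
  rw [Subgroup.closure_le]
  rintro _ ⟨g, rfl⟩
  refine Subgroup.subset_closure ⟨g ^ p, ?_⟩
  simp only [← pow_mul]
  congr 1
  ring

/-- A uniform pro-`p` group: a profinite group all of whose open normal subgroups have `p`-power
index, which for some `l` is topologically generated by `l` elements and satisfies
`G^{pⁿ} / G^{pⁿ⁺¹} ≃ (ℤ/p)^l` for all `n`. -/
class IsUniformProP (p : ℕ) (G : Type*) [Group G] [TopologicalSpace G] [IsTopologicalGroup G] :
    Prop where
  compact : CompactSpace G
  hausdorff : T2Space G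
  totallyDisconnected : TotallyDisconnectedSpace G
  pro_p : ∀ N : Subgroup G, N.Normal → IsOpen (N : Set G) → ∃ k : ℕ, N.index = p ^ k
  uniform : ∃ l : ℕ,
    (∃ s : Fin l → G, (Subgroup.closure (Set.range s)).topologicalClosure = ⊤) ∧
    ∀ n : ℕ, Nonempty ((powSubgroup p G n ⧸
      (powSubgroup p G (n + 1)).subgroupOf (powSubgroup p G n)) ≃*
        Multiplicative (Fin l → ZMod p))

/-- The finite quotient `G^{(n)} = G / G^{pⁿ}`. -/
abbrev Level (p : ℕ) (G : Type*) [Group G] [TopologicalSpace G] [IsTopologicalGroup G] (n : ℕ) :=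
  G ⧸ powSubgroup p G n

variable (p : ℕ) [Fact p.Prime] (G : Type*) [Group G] [TopologicalSpace G] [IsTopologicalGroup G]

instance level_finite [hG : IsUniformProP p G] (n : ℕ) : Finite (Level p G n) := by
  obtain ⟨l, -, h⟩ := hG.uniform
  have hidx : (powSubgroup p G n).index ≠ 0 := by
    induction n with
    | zero =>
      have : powSubgroup p G 0 = ⊤ := by
        rw [eq_top_iff]
        intro g _
        exact Subgroup.le_topologicalClosure _ (Subgroup.subset_closure ⟨g, by simp⟩)
      simp [this]
    | succ n ih =>
      rw [← Subgroup.relIndex_mul_index (powSubgroup_succ_le p G n)]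
      refine mul_ne_zero ?_ ih
      obtain ⟨e⟩ := h n
      rw [Subgroup.relIndex, Subgroup.index, Nat.card_congr e.toEquiv]
      exact Nat.card_pos.ne'
  have : (powSubgroup p G n).FiniteIndex := ⟨hidx⟩
  exact Subgroup.finite_quotient_of_finiteIndex

/-- The projection `G^{(n+1)} → G^{(n)}`. -/
def levelMap (n : ℕ) : Level p G (n + 1) →* Level p G n :=
  QuotientGroup.map _ _ (MonoidHom.id G) (powSubgroup_succ_le p G n)

theorem levelMap_mk (n : ℕ) (g : G) :
    levelMap p G n (g : Level p G (n + 1)) = (g : Level p G n) := rfl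

theorem levelMap_surjective (n : ℕ) : Function.Surjective (levelMap p G n) := by
  intro x
  obtain ⟨g, rfl⟩ := QuotientGroup.mk_surjective x
  exact ⟨g, rfl⟩

/-- The Iwasawa algebra `Λ = ℤ_p⟦G⟧ = lim ℤ_p[G^{(n)}]`. -/
noncomputable def iwasawaSubalgebra :
    Subalgebra ℤ_[p] (Π n, MonoidAlgebra ℤ_[p] (Level p G n)) where
  carrier := {x | ∀ n, MonoidAlgebra.mapDomainRingHom ℤ_[p] (levelMap p G n) (x (n + 1)) = x n}
  mul_mem' hx hy n := by rw [Pi.mul_apply, map_mul, hx n, hy n, Pi.mul_apply]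
  add_mem' hx hy n := by rw [Pi.add_apply, map_add, hx n, hy n, Pi.add_apply]
  algebraMap_mem' r n := by simp [MonoidAlgebra.coe_algebraMap]

/-- The Iwasawa algebra `Λ = ℤ_p⟦G⟧`. -/
abbrev IwasawaAlgebra : Type _ := ↥(iwasawaSubalgebra p G)

/-- The projection `πₙ : Λ → ℤ_p[G^{(n)}]`. -/
noncomputable def proj (n : ℕ) : IwasawaAlgebra p G →+* MonoidAlgebra ℤ_[p] (Level p G n) :=
  (Pi.evalRingHom (fun n => MonoidAlgebra ℤ_[p] (Level p G n)) n).comp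
    (iwasawaSubalgebra p G).val.toRingHom

theorem proj_succ (n : ℕ) (x : IwasawaAlgebra p G) :
    MonoidAlgebra.mapDomainRingHom ℤ_[p] (levelMap p G n) (proj p G (n + 1) x) = proj p G n x :=
  x.2 n

/-- The inclusion `G → Λ`. -/
noncomputable def grp : G →* IwasawaAlgebra p G where
  toFun g := ⟨fun n => MonoidAlgebra.of ℤ_[p] _ (g : Level p G n), fun n => by
    simp [levelMap_mk]⟩
  map_one' := Subtype.ext (funext fun n => by simp [MonoidAlgebra.one_def])
  map_mul' g h := Subtype.ext (funext fun n => by simp)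

end Uniform

section Fitting

/-- The inclusion `ℤ_p[H] → ℚ_p[H]`. -/
noncomputable def toRat (p : ℕ) [Fact p.Prime] (H : Type*) [Group H] :
    MonoidAlgebra ℤ_[p] H →+* MonoidAlgebra ℚ_[p] H :=
  MonoidAlgebra.mapRingHom H (algebraMap ℤ_[p] ℚ_[p])

/-- The additive group underlying `I(ℤ_p[H])`: the `Z(ℤ_p[H])`-submodule of `Z(ℚ_p[H])` generated by
the reduced norms of all square matrices over `ℤ_p[H]`. -/
noncomputable def fittGroup (p : ℕ) [Fact p.Prime] (H : Type*) [Group H] [Finite H] :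
    AddSubgroup (Subring.center (MonoidAlgebra ℚ_[p] H)) :=
  AddSubgroup.closure {x | ∃ c ∈ Subring.center (MonoidAlgebra ℤ_[p] H), ∃ (b : ℕ)
    (M : Matrix (Fin b) (Fin b) (MonoidAlgebra ℤ_[p] H)),
      (x : MonoidAlgebra ℚ_[p] H) = toRat p H c * nrd (M.map (toRat p H))}

theorem nrd_mem_fittGroup (p : ℕ) [Fact p.Prime] {H : Type*} [Group H] [Finite H]
    {ι : Type*} [Fintype ι] [DecidableEq ι] (M : Matrix ι ι (MonoidAlgebra ℤ_[p] H)) :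
    nrd (M.map (toRat p H)) ∈ fittGroup p H := by
  refine AddSubgroup.subset_closure ⟨1, one_mem _, Fintype.card ι,
    Matrix.reindex (Fintype.equivFin ι) (Fintype.equivFin ι) M, ?_⟩
  rw [map_one, one_mul, ← nrd_reindex (Fintype.equivFin ι)]
  rfl

/-- `I(ℤ_p[H])`, a subring of `Z(ℚ_p[H])`. -/
noncomputable def fittRing (p : ℕ) [Fact p.Prime] (H : Type*) [Group H] [Finite H] :
    Subring (Subring.center (MonoidAlgebra ℚ_[p] H)) where
  __ := fittGroup p H
  one_mem' := by
    have := nrd_mem_fittGroup p (H := H) (1 : Matrix (Fin 0) (Fin 0) (MonoidAlgebra ℤ_[p] H))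
    rwa [Matrix.map_one _ (map_zero _) (map_one _), nrd_one] at this
  mul_mem' {x y} hx hy := by
    induction hx, hy using AddSubgroup.closure_induction₂ with
    | mem x y hx hy =>
      obtain ⟨c, hc, b, M, hx⟩ := hx
      obtain ⟨c', hc', b', M', hy⟩ := hy
      refine AddSubgroup.subset_closure ⟨c * c', mul_mem hc hc', b + b',
        Matrix.reindex finSumFinEquiv finSumFinEquiv (Matrix.fromBlocks M 0 0 M'), ?_⟩
      have h1 : (Matrix.reindex finSumFinEquiv finSumFinEquiv
          (Matrix.fromBlocks M 0 0 M')).map (toRat p H) =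
          Matrix.reindex finSumFinEquiv finSumFinEquiv
            (Matrix.fromBlocks (M.map (toRat p H)) 0 0 (M'.map (toRat p H))) := by
        rw [← Matrix.map_zero (toRat p H) (map_zero _), ← Matrix.map_zero (toRat p H) (map_zero _),
          ← Matrix.fromBlocks_map]
        rfl
      rw [h1, nrd_reindex, nrd_fromBlocks, Subring.coe_mul, Subring.coe_mul, hx, hy, map_mul]
      have h2 := Subring.mem_center_iff.mp (nrd (M.map (toRat p H))).2 (toRat p H c')
      simp only [mul_assoc]
      congr 1
      simp only [← mul_assoc]
      rw [h2]
    | zero_left y _ => rw [zero_mul]; exact zero_mem (fittGroup p H)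
    | zero_right x _ => rw [mul_zero]; exact zero_mem (fittGroup p H)
    | add_left x y z _ _ _ h1 h2 => rw [add_mul]; exact (fittGroup p H).add_mem h1 h2
    | add_right x y z _ _ _ h1 h2 => rw [mul_add]; exact (fittGroup p H).add_mem h1 h2
    | neg_left x y _ _ h => rw [neg_mul]; exact (fittGroup p H).neg_mem h
    | neg_right x y _ _ h => rw [mul_neg]; exact (fittGroup p H).neg_mem h

variable (p : ℕ) [Fact p.Prime] (G : Type*) [Group G] [TopologicalSpace G] [IsTopologicalGroup G]
  [IsUniformProP p G]

/-- `I(Λ) = lim I(ℤ_p[G^{(n)}])` as a subring of `∏ Z(ℚ_p[G^{(n)}])`. -/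
noncomputable def fittRingLim :
    Subring (Π n, Subring.center (MonoidAlgebra ℚ_[p] (Level p G n))) where
  carrier := {x | ∀ n, x n ∈ fittRing p (Level p G n) ∧
    MonoidAlgebra.mapDomainRingHom ℚ_[p] (levelMap p G n)
      (x (n + 1) : MonoidAlgebra ℚ_[p] (Level p G (n + 1))) = x n}
  mul_mem' hx hy n := ⟨mul_mem (hx n).1 (hy n).1, by
    simp only [Pi.mul_apply, Subring.coe_mul, map_mul, (hx n).2, (hy n).2]⟩
  one_mem' n := ⟨one_mem _, by simp only [Pi.one_apply, Subring.coe_one, map_one]⟩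
  add_mem' hx hy n := ⟨add_mem (hx n).1 (hy n).1, by
    simp only [Pi.add_apply, Subring.coe_add, map_add, (hx n).2, (hy n).2]⟩
  zero_mem' n := ⟨zero_mem _, by simp only [Pi.zero_apply, Subring.coe_zero, map_zero]⟩
  neg_mem' hx n := ⟨neg_mem (hx n).1, by
    simp only [Pi.neg_apply, Subring.coe_neg, map_neg, (hx n).2]⟩

/-- The commutative ring `I(Λ)`. -/
def FittRing : Type _ := ↥(fittRingLim p G)

noncomputable instance : CommRing (FittRing p G) := inferInstanceAs (CommRing ↥(fittRingLim p G))

variable {p G} {ι : Type*} [Fintype ι] [DecidableEq ι]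

/-- The matrix `πₙ(M)` over `ℚ_p[G^{(n)}]`. -/
noncomputable def levelMatrix (n : ℕ) (M : Matrix ι ι (IwasawaAlgebra p G)) :
    Matrix ι ι (MonoidAlgebra ℚ_[p] (Level p G n)) :=
  M.map fun x => toRat p (Level p G n) (proj p G n x)

/-- The `Λ`-linear map `Λ^a → Λ^b` of left modules described by a `b × a` matrix `h`: the image of
the `j`-th basis vector is the `j`-th column of `h`. -/
noncomputable def colMap {a b : ℕ} (h : Matrix (Fin b) (Fin a) (IwasawaAlgebra p G)) :
    (Fin a → IwasawaAlgebra p G) →ₗ[IwasawaAlgebra p G] (Fin b → IwasawaAlgebra p G) :=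
  h.transpose.vecMulLinear

/-- `Nrd(M) ∈ I(Λ)` for a square matrix `M` over `Λ`, the limit of the reduced norms at the finite
levels. As for presentations, `M` stands for the endomorphism of the free left module `Λ^ι` that
sends basis vectors to the columns of `M`, i.e. for a matrix over `End_Λ(Λ) = Λᵒᵖ`, and `Nrd(M)` is
the reduced norm of this endomorphism. The endomorphism is right multiplication of row vectors by
`Mᵀ`, and the reduced norm of right multiplication by a matrix `N` over `ℚ_p[H]` is `nrd N`. -/
noncomputable def Nrd (M : Matrix ι ι (IwasawaAlgebra p G)) : FittRing p G :=
  (⟨fun n => nrd (levelMatrix n M).transpose, fun n => by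
    constructor
    · exact nrd_mem_fittGroup p ((M.map (proj p G n)).transpose)
    · rw [nrd_mapDomain _ (levelMap_surjective p G n)]
      congr 2
      funext i j
      simp only [Matrix.map_apply, Matrix.transpose_apply, levelMatrix]
      rw [← proj_succ p G n]
      exact (RingHom.congr_fun (MonoidAlgebra.mapRingHom_comp_mapDomainRingHom
        (algebraMap ℤ_[p] ℚ_[p]) (levelMap p G n)) _).symm⟩ : fittRingLim p G)

/-- The reduced norm of an element of `Λ`. -/
noncomputable def NrdElt (x : IwasawaAlgebra p G) : FittRing p G :=
  Nrd (Matrix.of fun _ _ : Fin 1 => x)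

variable (p G)

/-- The Fitting invariant of a left `Λ`-module `N`: the ideal of `I(Λ)` generated by the reduced
norms of all `b × b` submatrices of all `h`, where `Λ^a → Λ^b → N → 0` is any finite presentation
of `N` with matrix `h`. -/
noncomputable def fitt (N : Type*) [AddCommGroup N] [Module (IwasawaAlgebra p G) N] :
    Ideal (FittRing p G) :=
  Ideal.span {z | ∃ (a b : ℕ) (h : Matrix (Fin b) (Fin a) (IwasawaAlgebra p G))
    (φ : (Fin b → IwasawaAlgebra p G) →ₗ[IwasawaAlgebra p G] N),
      Function.Exact (colMap h) φ ∧ Function.Surjective φ ∧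
      ∃ c : Fin b ↪o Fin a, z = Nrd (h.submatrix id c)}

end Fitting

section Graphs

/-- A multigraph with loops and multiple edges allowed; `src` and `tgt` fix an orientation of every
edge. -/
structure Multigraph (V E : Type*) where
  src : E → V
  tgt : E → V

namespace Multigraph

variable {V E : Type*} (X : Multigraph V E)

/-- The initial vertex of a directed edge: `inl e` is `e` with its orientation, `inr e` is the
reverse of `e`. In particular a loop gives two directed edges. -/
def init : E ⊕ E → V := Sum.elim X.src X.tgt

/-- The terminal vertex of a directed edge. -/
def term : E ⊕ E → V := Sum.elim X.tgt X.src

/-- Connectedness (this includes that there is a vertex). -/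
def Connected : Prop :=
  (SimpleGraph.fromRel fun v w => ∃ e, X.src e = v ∧ X.tgt e = w).Connected

/-- The derived graph of a voltage assignment `α`: the edge `e` from `v` to `w` gives edges from
`(v, h)` to `(w, h α(e))`. -/
def derived {H : Type*} [Group H] (α : E → H) : Multigraph (V × H) (E × H) where
  src x := (X.src x.1, x.2)
  tgt x := (X.tgt x.1, x.2 * α x.1)

variable (p : ℕ) [Fact p.Prime]

noncomputable instance instAddCommGroupDiv (W : Type*) : AddCommGroup (W →₀ ℤ_[p]) :=
  Finsupp.instAddCommGroup

/-- The divisor `∑ (v - w)` of the firing move at `v`, the sum over all directed edges from `v`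
to some `w`. -/
noncomputable def firing (v : V) : V →₀ ℤ_[p] :=
  ∑ᶠ (d : E ⊕ E) (_ : X.init d = v), (Finsupp.single v 1 - Finsupp.single (X.term d) 1)

/-- `Pr(X)`, a submodule of `Div(X) = ⨁_v ℤ_p v`. -/
noncomputable def pr : Submodule ℤ_[p] (V →₀ ℤ_[p]) :=
  Submodule.span ℤ_[p] (Set.range (X.firing p))

/-- `Div⁰(X)`. -/
noncomputable def div0 (V : Type*) : Submodule ℤ_[p] (V →₀ ℤ_[p]) :=
  LinearMap.ker (Finsupp.linearCombination ℤ_[p] fun _ : V => (1 : ℤ_[p]))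

theorem pr_le_div0 : X.pr p ≤ div0 p V := by
  rw [pr, Submodule.span_le]
  rintro _ ⟨v, rfl⟩
  refine finsum_induction (· ∈ div0 p V) (zero_mem _) (fun _ _ => add_mem) fun d =>
    finsum_induction (· ∈ div0 p V) (zero_mem _) (fun _ _ => add_mem) fun _ => ?_
  simp [div0]

/-- `J(X) = Div⁰(X) / Pr(X)`. -/
abbrev Jac := div0 p V ⧸ (X.pr p).submoduleOf (div0 p V)

section Derived

variable {H : Type*} [Group H] (α : E → H)

/-- The voltage of a directed edge. -/
def voltage : E ⊕ E → H := Sum.elim α fun e => (α e)⁻¹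

/-- The firing move at a vertex of the derived graph. -/
theorem firing_derived (x : V × H) : (X.derived α).firing p x =
    ∑ᶠ (d : E ⊕ E) (_ : X.init d = x.1),
      (Finsupp.single x 1 - Finsupp.single (X.term d, x.2 * voltage α d) 1) := by
  have key : ∀ {M : Type _} [AddCommMonoid M] (f : V × H → M),
      (∑ᶠ (d : (E × H) ⊕ (E × H)) (_ : (X.derived α).init d = x), f ((X.derived α).term d)) =
      ∑ᶠ (d : E ⊕ E) (_ : X.init d = x.1), f (X.term d, x.2 * voltage α d) := by
    intro M _ f
    refine finsum_mem_eq_of_bijOn (s := {d | (X.derived α).init d = x}) (t := {d | X.init d = x.1})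
      (Sum.map Prod.fst Prod.fst) ⟨?_, ?_, ?_⟩ ?_
    · rintro (⟨e, h⟩ | ⟨e, h⟩) rfl <;> rfl
    · rintro (⟨e, h⟩ | ⟨e, h⟩) hd (⟨e', h'⟩ | ⟨e', h'⟩) hd' hdd'
      · have h1 : h = x.2 := congrArg Prod.snd hd
        have h2 : h' = x.2 := congrArg Prod.snd hd'
        have h3 : e = e' := Sum.inl.inj hdd'
        rw [h1, h2, h3]
      · cases hdd'
      · cases hdd'
      · have h1 : h * α e = x.2 := congrArg Prod.snd hd
        have h2 : h' * α e' = x.2 := congrArg Prod.snd hd'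
        have h3 : e = e' := Sum.inr.inj hdd'
        subst h3
        rw [mul_right_cancel (h1.trans h2.symm)]
    · rintro (e | e) hd
      · exact ⟨Sum.inl (e, x.2), Prod.ext hd rfl, rfl⟩
      · exact ⟨Sum.inr (e, x.2 * (α e)⁻¹), Prod.ext hd (inv_mul_cancel_right _ _), rfl⟩
    · rintro (⟨e, h⟩ | ⟨e, h⟩) rfl
      · rfl
      · simp [init, term, derived, voltage]
  exact key fun w => Finsupp.single x 1 - Finsupp.single w 1

/-- The map `Div → Div`, `(v, h) ↦ (v, f h)`, on divisors of derived graphs. -/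
noncomputable def divMap (V : Type*) {H' : Type*} (f : H → H') :
    (V × H →₀ ℤ_[p]) →ₗ[ℤ_[p]] (V × H' →₀ ℤ_[p]) :=
  Finsupp.lmapDomain ℤ_[p] ℤ_[p] (Prod.map id f)

theorem divMap_mem_div0 {H' : Type*} (f : H → H') (x : V × H →₀ ℤ_[p])
    (hx : x ∈ div0 p (V × H)) : divMap p V f x ∈ div0 p (V × H') := by
  rw [div0, LinearMap.mem_ker] at hx ⊢
  rw [← hx, divMap, Finsupp.lmapDomain_apply, Finsupp.linearCombination_mapDomain]
  rfl

variable {α} [Finite E] {H' : Type*} [Group H'] {β : E → H'}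

theorem divMap_firing (f : H → H') (hf : ∀ h e, f (h * α e) = f h * β e) (x : V × H) :
    divMap p V f ((X.derived α).firing p x) = (X.derived β).firing p (x.1, f x.2) := by
  have hv : ∀ h d, f (h * voltage α d) = f h * voltage β d := by
    rintro h (e | e)
    · exact hf h e
    · have := hf (h * (α e)⁻¹) e
      rw [inv_mul_cancel_right] at this
      exact eq_mul_inv_of_mul_eq this.symm
  rw [firing_derived, firing_derived]
  have h1 := (divMap p V f).toAddMonoidHom.map_finsum_mem
    (fun d => (Finsupp.single x 1 - Finsupp.single (X.term d, x.2 * voltage α d) 1 :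
      V × H →₀ ℤ_[p])) (Set.toFinite {d | X.init d = x.1})
  refine h1.trans (finsum_congr fun d => finsum_congr fun _ => ?_)
  change divMap p V f (_ - _) = _
  rw [map_sub]
  simp [divMap, hv, Prod.map]

/-- The map `J → J` induced by `(v, h) ↦ (v, f h)` on the Jacobians of derived graphs. -/
noncomputable def jacMap (f : H → H') (hf : ∀ h e, f (h * α e) = f h * β e) :
    (X.derived α).Jac p →ₗ[ℤ_[p]] (X.derived β).Jac p :=
  Submodule.mapQ _ _ ((divMap p V f).restrict (divMap_mem_div0 p f)) (by
    have h : (X.derived α).pr p ≤ ((X.derived β).pr p).comap (divMap p V f) := by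
      rw [pr, Submodule.span_le]
      rintro _ ⟨x, rfl⟩
      exact Submodule.subset_span ⟨_, (X.divMap_firing p f hf x).symm⟩
    exact fun y hy => h hy)

theorem jacMap_jacMap {H'' : Type*} [Group H''] {γ : E → H''}
    (f : H → H') (hf : ∀ h e, f (h * α e) = f h * β e)
    (f' : H' → H'') (hf' : ∀ h e, f' (h * β e) = f' h * γ e)
    (f'' : H → H'') (hf'' : ∀ h e, f'' (h * α e) = f'' h * γ e) (hc : ∀ h, f' (f h) = f'' h)
    (y : (X.derived α).Jac p) :
    X.jacMap p f' hf' (X.jacMap p f hf y) = X.jacMap p f'' hf'' y := by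
  obtain ⟨y, rfl⟩ := Submodule.mkQ_surjective _ y
  refine congrArg (Submodule.mkQ _) (Subtype.ext ?_)
  change divMap p V f' (divMap p V f y.1) = divMap p V f'' y.1
  obtain rfl : f' ∘ f = f'' := funext hc
  simp only [divMap, Finsupp.lmapDomain_apply, ← Finsupp.mapDomain_comp]
  rfl

theorem jacMap_id (f : H → H) (hf : ∀ h e, f (h * α e) = f h * α e) (hc : ∀ h, f h = h)
    (y : (X.derived α).Jac p) : X.jacMap p f hf y = y := by
  obtain rfl : f = id := funext hc
  obtain ⟨y, rfl⟩ := Submodule.mkQ_surjective _ y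
  refine congrArg (Submodule.mkQ _) (Subtype.ext ?_)
  change divMap p V id y.1 = y.1
  simp [divMap]

variable (α)

/-- The action of `H` on the Jacobian of the derived graph induced by `g (v, h) = (v, g h)`. -/
noncomputable def jacRep : Representation ℤ_[p] H ((X.derived α).Jac p) where
  toFun g := X.jacMap p (g * ·) fun _ _ => (mul_assoc _ _ _).symm
  map_one' := LinearMap.ext fun y => X.jacMap_id p _ _ one_mul y
  map_mul' g h := LinearMap.ext fun y =>
    (X.jacMap_jacMap p (h * ·) _ (g * ·) (fun _ _ => (mul_assoc _ _ _).symm) _ _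
      (fun _ => (mul_assoc _ _ _).symm) y).symm

/-- The Jacobian of the derived graph of `α : E → H` as a left `ℤ_p[H]`-module. -/
def JacMod : Type _ := (X.jacRep p α).asModule

noncomputable instance : AddCommGroup (X.JacMod p α) :=
  inferInstanceAs (AddCommGroup (X.jacRep p α).asModule)

noncomputable instance : Module ℤ_[p] (X.JacMod p α) :=
  inferInstanceAs (Module ℤ_[p] (X.jacRep p α).asModule)

noncomputable instance : Module (MonoidAlgebra ℤ_[p] H) (X.JacMod p α) :=
  inferInstanceAs (Module (MonoidAlgebra ℤ_[p] H) (X.jacRep p α).asModule)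

variable {α}

/-- The projection of Jacobians along a group homomorphism is semilinear. -/
theorem jacMap_smul (f : H →* H') (hf : ∀ e, f (α e) = β e) (a : MonoidAlgebra ℤ_[p] H)
    (y : (X.jacRep p α).asModule) :
    X.jacMap p f (fun h e => by rw [map_mul, hf])
        ((X.jacRep p α).asModuleEquiv (a • y)) =
      (X.jacRep p β).asModuleEquiv (MonoidAlgebra.mapDomainRingHom ℤ_[p] f a •
        (X.jacRep p β).asModuleEquiv.symm (X.jacMap p f (fun h e => by rw [map_mul, hf])
          ((X.jacRep p α).asModuleEquiv y))) := by
  induction a using MonoidAlgebra.induction_linear with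
  | zero => simp
  | add a b ha hb => rw [add_smul, map_add, map_add, ha, hb, map_add, add_smul, map_add]
  | single h c =>
    simp only [Representation.asModuleEquiv_map_smul, MonoidAlgebra.mapDomainRingHom_apply,
      MonoidAlgebra.mapDomain_single, Representation.asAlgebraHom_single, LinearMap.smul_apply,
      map_smul, LinearEquiv.apply_symm_apply]
    congr 1
    exact (X.jacMap_jacMap p (γ := β) (h * ·) (fun _ _ => (mul_assoc _ _ _).symm) _ _ (fun g => f (h * g))
      (fun g e => by rw [← mul_assoc, map_mul, hf])
      (fun _ => rfl) _).trans
      (X.jacMap_jacMap p _ _ (f h * ·) (fun _ _ => (mul_assoc _ _ _).symm) _ _ (fun g => (map_mul f h g).symm) _).symm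

end Derived

section Tower

variable [Finite E] {G : Type*} [Group G] [TopologicalSpace G] [IsTopologicalGroup G] (α : E → G)

/-- The voltage assignment `αₙ : E → G^{(n)}` induced by `α`. -/
def levelVoltage (n : ℕ) (e : E) : Level p G n := (α e : Level p G n)

/-- `J(Xₙ)`, where `Xₙ` is the derived graph of `αₙ`. -/
def JacLevel (n : ℕ) : Type _ := X.JacMod p (levelVoltage p α n)

noncomputable instance (n : ℕ) : AddCommGroup (X.JacLevel p α n) :=
  inferInstanceAs (AddCommGroup (X.JacMod p (levelVoltage p α n)))

/-- `Λ` acts on `J(Xₙ)` through `πₙ : Λ → ℤ_p[G^{(n)}]`. -/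
noncomputable instance (n : ℕ) : Module (IwasawaAlgebra p G) (X.JacLevel p α n) :=
  Module.compHom (X.JacMod p (levelVoltage p α n)) (proj p G n)

/-- The projection `J(Xₙ₊₁) → J(Xₙ)`. -/
noncomputable def jacTrans (n : ℕ) : X.JacLevel p α (n + 1) →+ X.JacLevel p α n :=
  (X.jacMap p (levelMap p G n) (fun _ _ => map_mul _ _ _) :
    (X.derived (levelVoltage p α (n + 1))).Jac p →ₗ[ℤ_[p]]
      (X.derived (levelVoltage p α n)).Jac p).toAddMonoidHom

theorem jacTrans_smul (n : ℕ) (a : IwasawaAlgebra p G) (y : X.JacLevel p α (n + 1)) :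
    X.jacTrans p α n (a • y) = a • X.jacTrans p α n y := by
  have h := X.jacMap_smul p (α := levelVoltage p α (n + 1)) (β := levelVoltage p α n)
    (levelMap p G n) (fun _ => rfl) (proj p G (n + 1) a) y
  rw [proj_succ] at h
  exact h

/-- `J_∞ = lim J(Xₙ)`. -/
noncomputable def jacLim : Submodule (IwasawaAlgebra p G) (Π n, X.JacLevel p α n) where
  carrier := {y | ∀ n, X.jacTrans p α n (y (n + 1)) = y n}
  add_mem' hx hy n := by rw [Pi.add_apply, map_add, hx n, hy n, Pi.add_apply]
  zero_mem' n := map_zero _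
  smul_mem' a y hy n := by rw [Pi.smul_apply, jacTrans_smul, hy n, Pi.smul_apply]

noncomputable instance : AddCommGroup (TensorProduct ℤ_[p] (IwasawaAlgebra p G) (X.JacMod p α)) :=
  TensorProduct.addCommGroup

/-- `Λ ⊗_R J(X_∞)`, where `R = ℤ_p[G]` and `X_∞` is the derived graph of `α`: the quotient of
`Λ ⊗_{ℤ_p} J(X_∞)` by the relations `x r ⊗ y = x ⊗ r y` for `r ∈ R`. -/
def JacTensor : Type _ :=
  TensorProduct ℤ_[p] (IwasawaAlgebra p G) (X.JacMod p α) ⧸ Submodule.span (IwasawaAlgebra p G)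
    {z | ∃ (x : IwasawaAlgebra p G) (r : MonoidAlgebra ℤ_[p] G) (y : X.JacMod p α),
      z = TensorProduct.tmul ℤ_[p]
          (x * MonoidAlgebra.lift ℤ_[p] (IwasawaAlgebra p G) G (grp p G) r) y -
        TensorProduct.tmul ℤ_[p] x (r • y)}

noncomputable instance : AddCommGroup (X.JacTensor p α) :=
  inferInstanceAs (AddCommGroup (_ ⧸ _))

noncomputable instance : Module (IwasawaAlgebra p G) (X.JacTensor p α) :=
  inferInstanceAs (Module (IwasawaAlgebra p G) (_ ⧸ _))

end Tower

section Matrices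

variable (G : Type*) [Group G] [TopologicalSpace G] [IsTopologicalGroup G]
  [Fintype E] [DecidableEq V]

/-- The degree matrix `D` over `Λ`; the degree of `v` is the number of directed edges starting
at `v`. -/
noncomputable def degreeMatrix : Matrix V V (IwasawaAlgebra p G) :=
  Matrix.diagonal fun v => ((Finset.univ.filter fun d => X.init d = v).card : IwasawaAlgebra p G)

variable {G}

/-- The adjacency matrix `A_α`: the `(v, w)` entry is the sum of the voltages of all directed edges
from `v` to `w`. -/
noncomputable def voltageMatrix (α : E → G) : Matrix V V (IwasawaAlgebra p G) :=
  Matrix.of fun v w =>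
    ∑ d ∈ Finset.univ.filter (fun d => X.init d = v ∧ X.term d = w), grp p G (voltage α d)

end Matrices

end Multigraph
end Graphs
end NCIwasawa

set_option linter.unusedSectionVars false

/-! Let `L = D - A_α` act from the right on row vectors, and let `Pic` be the quotient of the left
module `Λ^V` by the span of the rows of `L`. The map `(v, h) ↦ h e_v` turns firing moves into
multiples of rows of `L`, so Jacobians map to `Pic`. Modulo the image of degree-zero divisors all
vertices become equal to one vertex `v₀`, and every `g - 1` kills `v₀`. Only the image of the
Jacobian in `Pic` matters, not the kernel of the map.

If `h` presents the Jacobian, its `b` generators together with `v₀` generate `Pic`. A `b × b`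
submatrix of `h`, bordered by a row expressing `(g - 1) v₀` through the other generators, is a
square block triangular matrix of relations with reduced norm `Nrd(H) Nrd(g - 1)`
(`fitt_mul_le_span_rowNrd`). Since `L` is a square matrix generating all relations of `Pic`, its
reduced norm divides that of any square matrix of relations among any finite set of generators
(`rowNrd_dvd_of_range_eq`). The latter is a block matrix identity, which needs only that `Nrd` is
multiplicative and behaves well on triangular blocks.

For `Λ ⊗ J(X_∞)` this applies directly. For `J_∞` the role of `Pic` is played by the image of `Λ^V`
in the product of the cokernels at the finite levels. That this image contains the image of `J_∞`,
and that its relations are still generated by the rows of `L`, both follow from the compactness of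
finite free `ℤ_p`-modules (`exists_compatible_of_sub_mem`). -/

namespace NCIwasawa

/-! ### Compactness and inverse limits -/

section InverseLimit

/-- A sequence of compatible nonempty closed subsets of compact Hausdorff spaces has a compatible
system of points. -/
theorem exists_compatible_of_compact {M : ℕ → Type*} [∀ n, TopologicalSpace (M n)]
    [∀ n, CompactSpace (M n)] [∀ n, T2Space (M n)] (t : ∀ n, M (n + 1) → M n)
    (ht : ∀ n, Continuous (t n)) (S : ∀ n, Set (M n)) (hS : ∀ n, IsClosed (S n))
    (hne : ∀ n, (S n).Nonempty) (hmap : ∀ n, ∀ x ∈ S (n + 1), t n x ∈ S n) :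
    ∃ z : ∀ n, M n, (∀ n, z n ∈ S n) ∧ ∀ n, t n (z (n + 1)) = z n := by
  classical
  -- `C m` imposes the conditions up to index `m` only. These sets are closed and decreasing in a
  -- compact product, so it suffices that each is nonempty.
  let C : ℕ → Set (∀ n, M n) := fun m =>
    {z | (∀ n ≤ m, z n ∈ S n) ∧ ∀ n < m, t n (z (n + 1)) = z n}
  have hC : ∀ m, ∀ w ∈ S m, ∃ z ∈ C m, z m = w := by
    intro m
    induction m with
    | zero =>
      intro w hw
      choose s hs using hne
      -- Coordinates above `0` are unconstrained in `C 0`, so any choice serves.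
      refine ⟨Function.update s 0 w, ⟨fun n hn => ?_, fun n hn => absurd hn n.not_lt_zero⟩,
        by simp⟩
      obtain rfl : n = 0 := by omega
      simpa using hw
    | succ m ih =>
      intro w hw
      obtain ⟨z, ⟨hz1, hz2⟩, hz3⟩ := ih (t m w) (hmap m w hw)
      -- The part up to `m` ends in `t m w`, so replacing the next coordinate by `w` gives
      -- compatibility at `m`.
      refine ⟨Function.update z (m + 1) w, ⟨fun n hn => ?_, fun n hn => ?_⟩, by simp⟩
      · rcases Nat.lt_or_ge m n with h | h
        · obtain rfl : n = m + 1 := by omega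
          simpa using hw
        · rw [Function.update_of_ne (by omega)]
          exact hz1 n h
      · rw [Function.update_of_ne (by omega : n ≠ m + 1)]
        rcases Nat.lt_or_ge n m with h | h
        · rw [Function.update_of_ne (by omega)]
          exact hz2 n h
        · obtain rfl : n = m := by omega
          rw [Function.update_self, hz3]
  have hclosed : ∀ m, IsClosed (C m) := by
    intro m
    have : C m = (⋂ n, ⋂ _ : n ≤ m, {z | z n ∈ S n}) ∩
        ⋂ n, ⋂ _ : n < m, {z | t n (z (n + 1)) = z n} := by
      ext z; simp [C]
    rw [this]
    exact (isClosed_iInter fun n => isClosed_iInter fun _ =>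
      (hS n).preimage (continuous_apply n)).inter
      (isClosed_iInter fun n => isClosed_iInter fun _ =>
        isClosed_eq ((ht n).comp (continuous_apply (n + 1))) (continuous_apply n))
  obtain ⟨z, hz⟩ := IsCompact.nonempty_iInter_of_sequence_nonempty_isCompact_isClosed C
    (fun m z hz => ⟨fun n hn => hz.1 n (by omega), fun n hn => hz.2 n (by omega)⟩)
    (fun m => by
      obtain ⟨w, hw⟩ := hne m
      obtain ⟨z, hz, -⟩ := hC m w hw
      exact ⟨z, hz⟩) (hclosed 0).isCompact hclosed
  rw [Set.mem_iInter] at hz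
  exact ⟨z, fun n => (hz n).1 n le_rfl, fun n => (hz (n + 1)).2 n n.lt_succ_self⟩

/-- A sequence of cosets of submodules, which is compatible up to these submodules, contains a
compatible sequence of elements, for finite free modules over a compact Noetherian ring. -/
theorem exists_compatible_of_sub_mem {R : Type*} [CommRing R] [TopologicalSpace R]
    [IsTopologicalRing R] [CompactSpace R] [T2Space R] [IsNoetherianRing R] {M : ℕ → Type*}
    [∀ n, AddCommGroup (M n)] [∀ n, Module R (M n)] [∀ n, Module.Finite R (M n)]
    [∀ n, Module.Free R (M n)] (t : ∀ n, M (n + 1) →ₗ[R] M n) (N : ∀ n, Submodule R (M n))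
    (hN : ∀ n, N (n + 1) ≤ (N n).comap (t n)) (y : ∀ n, M n)
    (hy : ∀ n, t n (y (n + 1)) - y n ∈ N n) :
    ∃ z : ∀ n, M n, (∀ n, z n - y n ∈ N n) ∧ ∀ n, t n (z (n + 1)) = z n := by
  -- In the module topology all linear maps are continuous: a surjection from `R^k` gives
  -- compactness, and coordinates in a basis give the Hausdorff property.
  let _ : ∀ n, TopologicalSpace (M n) := fun n => moduleTopology R (M n)
  have : ∀ n, IsModuleTopology R (M n) := fun n => ⟨rfl⟩
  have : ∀ n, ContinuousAdd (M n) := fun n => IsModuleTopology.toContinuousAdd R (M n)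
  have : ∀ n, CompactSpace (M n) := by
    intro n
    obtain ⟨k, f, hf⟩ := Module.Finite.exists_fin' R (M n)
    exact hf.compactSpace (IsModuleTopology.continuous_of_linearMap f)
  have : ∀ n, T2Space (M n) := fun n =>
    T2Space.of_injective_continuous (Module.Free.chooseBasis R (M n)).equivFun.injective
      (IsModuleTopology.continuous_of_linearMap
        (Module.Free.chooseBasis R (M n)).equivFun.toLinearMap)
  refine exists_compatible_of_compact (fun n => t n)
    (fun n => IsModuleTopology.continuous_of_linearMap (t n)) (fun n => {z | z - y n ∈ N n})
    (fun n => ?_) (fun n => ⟨y n, by simp⟩) (fun n x hx => ?_)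
  · obtain ⟨k, f, hf⟩ := Module.Finite.exists_fin' R (N n)
    -- As `R` is Noetherian, `N n` is an image of some `R^k`. The coset is therefore compact, hence
    -- closed.
    have h : {z | z - y n ∈ N n} = Set.range fun c => (f c : M n) + y n := by
      ext z
      constructor
      · intro hz
        obtain ⟨c, hc⟩ := hf ⟨_, hz⟩
        exact ⟨c, by simp [hc]⟩
      · rintro ⟨c, rfl⟩
        simp
    rw [h]
    exact (isCompact_range ((IsModuleTopology.continuous_of_linearMap
      ((N n).subtype ∘ₗ f)).add continuous_const)).isClosed
  -- Here `t x - yₙ = t (x - yₙ₊₁) + (t yₙ₊₁ - yₙ)`, and both terms lie in `N n`.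
  · have h := (N n).add_mem (Submodule.mem_comap.mp (hN n hx)) (hy n)
    rw [map_sub, sub_add_sub_cancel] at h
    exact h

end InverseLimit

/-! ### Multiplicativity of reduced norms -/

section ReducedNormProducts

variable {K A ι κ : Type*} [Field K] [Semiring A] [Fintype ι] [DecidableEq ι] [Fintype κ]
  [DecidableEq κ] {m : ℕ}

/-- Flattening block matrices is a ring isomorphism from `Mat_ι(Mat_m(K))` to `Mat_{ι × m}(K)`,
which reduces the claim to the determinant over a field. -/
theorem blockDet_mul (φ : A →+* Matrix (Fin m) (Fin m) K) (M N : Matrix ι ι A) :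
    blockDet φ (M * N) = blockDet φ M * blockDet φ N := by
  rw [blockDet, blockDet, blockDet, Matrix.map_mul, ← Matrix.det_mul]
  exact congrArg Matrix.det (map_mul (Matrix.compRingEquiv ι (Fin m) K) (M.map φ) (N.map φ))

theorem blockDet_fromBlocks_zero₁₂ (φ : A →+* Matrix (Fin m) (Fin m) K) (M : Matrix ι ι A)
    (C : Matrix κ ι A) (N : Matrix κ κ A) :
    blockDet φ (Matrix.fromBlocks M 0 C N) = blockDet φ M * blockDet φ N := by
  unfold blockDet
  rw [← Matrix.det_fromBlocks_zero₁₂ _ (Matrix.comp κ ι _ _ K (C.map φ)),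
    ← Matrix.det_reindex_self (Equiv.sumProdDistrib _ _ _)]
  congr 1
  ext (⟨u, a⟩ | ⟨u, a⟩) (⟨v, b⟩ | ⟨v, b⟩) <;> simp [Matrix.comp_apply]

theorem blockDet_fromBlocks_zero₂₁ (φ : A →+* Matrix (Fin m) (Fin m) K) (M : Matrix ι ι A)
    (B : Matrix ι κ A) (N : Matrix κ κ A) :
    blockDet φ (Matrix.fromBlocks M B 0 N) = blockDet φ M * blockDet φ N := by
  unfold blockDet
  rw [← Matrix.det_fromBlocks_zero₂₁ _ (Matrix.comp ι κ _ _ K (B.map φ)),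
    ← Matrix.det_reindex_self (Equiv.sumProdDistrib _ _ _)]
  congr 1
  ext (⟨u, a⟩ | ⟨u, a⟩) (⟨v, b⟩ | ⟨v, b⟩) <;> simp [Matrix.comp_apply]

variable {F H : Type*} [Field F] [CharZero F] [Group H] [Finite H]

/-- The `i`-th absolutely irreducible matrix representation of `F[H]`. -/
noncomputable def irrep (F H : Type*) [Field F] [CharZero F] [Group H] [Finite H]
    (i : Fin (numComp F H)) :
    MonoidAlgebra F H →+* Matrix (Fin (degComp F H i)) (Fin (degComp F H i))
      (AlgebraicClosure F) :=
  (Pi.evalRingHom _ i).comp ((wedderburn F H).toRingEquiv.toRingHom.comp toClosure)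

theorem wedderburn_nrd_eq_irrep (M : Matrix ι ι (MonoidAlgebra F H)) (i : Fin (numComp F H)) :
    wedderburn F H (toClosure (nrd M : MonoidAlgebra F H)) i =
      algebraMap (AlgebraicClosure F) _ (blockDet (irrep F H i) M) :=
  wedderburn_nrd M i

/-- Central elements can be compared in each Wedderburn component, where the reduced norm is the
scalar matrix of a block determinant. -/
theorem nrd_mul (M N : Matrix ι ι (MonoidAlgebra F H)) : nrd (M * N) = nrd M * nrd N := by
  apply nrd_ext
  intro i
  rw [Subring.coe_mul, map_mul, map_mul, Pi.mul_apply]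
  simp only [wedderburn_nrd_eq_irrep]
  rw [← map_mul, blockDet_mul]

theorem nrd_fromBlocks_zero₁₂ (M : Matrix ι ι (MonoidAlgebra F H))
    (C : Matrix κ ι (MonoidAlgebra F H)) (N : Matrix κ κ (MonoidAlgebra F H)) :
    nrd (Matrix.fromBlocks M 0 C N) = nrd M * nrd N := by
  apply nrd_ext
  intro i
  rw [Subring.coe_mul, map_mul, map_mul, Pi.mul_apply]
  simp only [wedderburn_nrd_eq_irrep]
  rw [← map_mul, blockDet_fromBlocks_zero₁₂]

theorem nrd_fromBlocks_zero₂₁ (M : Matrix ι ι (MonoidAlgebra F H))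
    (B : Matrix ι κ (MonoidAlgebra F H)) (N : Matrix κ κ (MonoidAlgebra F H)) :
    nrd (Matrix.fromBlocks M B 0 N) = nrd M * nrd N := by
  apply nrd_ext
  intro i
  rw [Subring.coe_mul, map_mul, map_mul, Pi.mul_apply]
  simp only [wedderburn_nrd_eq_irrep]
  rw [← map_mul, blockDet_fromBlocks_zero₂₁]

variable {p : ℕ} [Fact p.Prime] {G : Type*} [Group G] [TopologicalSpace G]
  [IsTopologicalGroup G] [IsUniformProP p G]

theorem FittRing.ext {x y : FittRing p G} (h : ∀ n, x.1 n = y.1 n) : x = y :=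
  Subtype.ext (funext h)

/-- The reduced norm of the endomorphism `x ↦ x M` of the left module `Λ^ι` of row vectors. -/
noncomputable def rowNrd (M : Matrix ι ι (IwasawaAlgebra p G)) : FittRing p G := Nrd M.transpose

/-- The ring homomorphism `Λ → ℚ_p[G^{(n)}]`. -/
noncomputable def ratProj (p : ℕ) [Fact p.Prime] (G : Type*) [Group G] [TopologicalSpace G]
    [IsTopologicalGroup G] (n : ℕ) :
    IwasawaAlgebra p G →+* MonoidAlgebra ℚ_[p] (Level p G n) :=
  (toRat p (Level p G n)).comp (proj p G n)

theorem rowNrd_apply (M : Matrix ι ι (IwasawaAlgebra p G)) (n : ℕ) :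
    (rowNrd M).1 n = nrd (M.map (ratProj p G n)) := rfl

theorem rowNrd_mul (M N : Matrix ι ι (IwasawaAlgebra p G)) :
    rowNrd (M * N) = rowNrd M * rowNrd N := by
  refine FittRing.ext fun n => ?_
  change _ = (rowNrd M).1 n * (rowNrd N).1 n
  simp only [rowNrd_apply]
  rw [Matrix.map_mul, nrd_mul]

theorem rowNrd_one : rowNrd (1 : Matrix ι ι (IwasawaAlgebra p G)) = 1 := by
  refine FittRing.ext fun n => ?_
  rw [rowNrd_apply, Matrix.map_one _ (map_zero _) (map_one _), nrd_one]
  rfl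

theorem rowNrd_fromBlocks_zero₁₂ (M : Matrix ι ι (IwasawaAlgebra p G))
    (C : Matrix κ ι (IwasawaAlgebra p G)) (N : Matrix κ κ (IwasawaAlgebra p G)) :
    rowNrd (Matrix.fromBlocks M 0 C N) = rowNrd M * rowNrd N := by
  refine FittRing.ext fun n => ?_
  change _ = (rowNrd M).1 n * (rowNrd N).1 n
  simp only [rowNrd_apply]
  rw [Matrix.fromBlocks_map, Matrix.map_zero _ (map_zero _), nrd_fromBlocks_zero₁₂]

theorem rowNrd_fromBlocks_zero₂₁ (M : Matrix ι ι (IwasawaAlgebra p G))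
    (B : Matrix ι κ (IwasawaAlgebra p G)) (N : Matrix κ κ (IwasawaAlgebra p G)) :
    rowNrd (Matrix.fromBlocks M B 0 N) = rowNrd M * rowNrd N := by
  refine FittRing.ext fun n => ?_
  change _ = (rowNrd M).1 n * (rowNrd N).1 n
  simp only [rowNrd_apply]
  rw [Matrix.fromBlocks_map, Matrix.map_zero _ (map_zero _), nrd_fromBlocks_zero₂₁]

end ReducedNormProducts

/-! ### Presentations and divisibility of reduced norms -/

section Presentations

variable {p : ℕ} [Fact p.Prime] {G : Type*} [Group G] [TopologicalSpace G]
  [IsTopologicalGroup G] [IsUniformProP p G]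

theorem exists_mul_eq_of_forall_row {A ι μ Q : Type*} [Ring A] [Fintype ι] [AddCommGroup Q]
    [Module A Q] (q : (ι → A) →ₗ[A] Q) (Φ : Matrix ι ι A)
    (hΦ : ∀ x, q x = 0 → ∃ z, Matrix.vecMul z Φ = x) (W : Matrix μ ι A)
    (hW : ∀ i, q (W i) = 0) : ∃ Z : Matrix μ ι A, Z * Φ = W :=
  ⟨fun i => (hΦ _ (hW i)).choose, funext fun i => (hΦ _ (hW i)).choose_spec⟩

/-- If two free modules have the same image in `Q`, where the rows of `Φ` generate the
relations of the first one, then `Nrd(Φ)` divides `Nrd(Ψ)` for every square matrix `Ψ` of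
relations of the second one. -/
theorem rowNrd_dvd_of_range_eq {ι κ Q : Type*} [Fintype ι] [DecidableEq ι] [Fintype κ]
    [DecidableEq κ] [AddCommGroup Q] [Module (IwasawaAlgebra p G) Q]
    (q : (ι → IwasawaAlgebra p G) →ₗ[IwasawaAlgebra p G] Q)
    (r : (κ → IwasawaAlgebra p G) →ₗ[IwasawaAlgebra p G] Q)
    (hqr : LinearMap.range q = LinearMap.range r)
    (Φ : Matrix ι ι (IwasawaAlgebra p G)) (hΦ : ∀ x, q x = 0 → ∃ z, Matrix.vecMul z Φ = x)
    (Ψ : Matrix κ κ (IwasawaAlgebra p G)) (hΨ : ∀ i, r (Ψ i) = 0) :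
    rowNrd Φ ∣ rowNrd Ψ := by
  -- The matrices `θ` and `η` express the generators of each side through those of the other; this
  -- is where equality of the images enters.
  obtain ⟨θ, hθ⟩ : ∃ θ : Matrix κ ι (IwasawaAlgebra p G), ∀ i, q (θ i) = r (Pi.single i 1) := by
    have h : ∀ i, ∃ x, q x = r (Pi.single i 1) := fun i =>
      LinearMap.mem_range.mp (hqr ▸ LinearMap.mem_range_self r _)
    exact ⟨fun i => (h i).choose, fun i => (h i).choose_spec⟩
  obtain ⟨η, hη⟩ : ∃ η : Matrix ι κ (IwasawaAlgebra p G), ∀ i, r (η i) = q (Pi.single i 1) := by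
    have h : ∀ i, ∃ x, r x = q (Pi.single i 1) := fun i =>
      LinearMap.mem_range.mp (hqr ▸ LinearMap.mem_range_self q _)
    exact ⟨fun i => (h i).choose, fun i => (h i).choose_spec⟩
  have hrow : ∀ x : κ → IwasawaAlgebra p G, q (Matrix.vecMul x θ) = r x := by
    intro x
    have h : q ∘ₗ θ.vecMulLinear = r := by
      refine LinearMap.pi_ext' fun i => LinearMap.ext_ring ?_
      simp only [LinearMap.comp_apply, LinearMap.single_apply, Matrix.vecMulLinear_apply]
      rw [Matrix.single_one_vecMul, ← hθ]
      rfl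
    rw [← h]
    rfl
  obtain ⟨Z₁, hZ₁⟩ := exists_mul_eq_of_forall_row q Φ hΦ (Ψ * θ) fun i => (hrow (Ψ i)).trans (hΨ i)
  -- Going from the first generators to the second and back changes each by a relation, since `q(ηᵢ
  -- θ) = r(ηᵢ) = q(eᵢ)`.
  obtain ⟨Z₂, hZ₂⟩ := exists_mul_eq_of_forall_row q Φ hΦ (1 - η * θ) fun i => by
    have h1 : (1 - η * θ : Matrix ι ι (IwasawaAlgebra p G)) i =
        Pi.single i 1 - Matrix.vecMul (η i) θ := by
      funext j
      simp [Matrix.one_apply, Pi.single_apply, Matrix.mul_apply, Matrix.vecMul, dotProduct,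
        eq_comm]
    rw [h1, map_sub, hrow, hη, sub_self]
  -- Both products equal the block matrix with rows `(Ψ, Ψθ)` and `(-η, 1 - ηθ)`. Its second block
  -- column consists of relations for `q`, so `Φ` can be split off on the right; on the left the
  -- remaining factors have reduced norms `Nrd(Ψ)` and `1`.
  have key : Matrix.fromBlocks Ψ 0 (-η) 1 * Matrix.fromBlocks 1 θ 0 1 =
      Matrix.fromBlocks Ψ Z₁ (-η) Z₂ * Matrix.fromBlocks 1 0 0 Φ := by
    rw [Matrix.fromBlocks_multiply, Matrix.fromBlocks_multiply]
    simp [hZ₁, hZ₂, sub_eq_neg_add]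
  have := congrArg rowNrd key
  rw [rowNrd_mul, rowNrd_mul, rowNrd_fromBlocks_zero₁₂, rowNrd_fromBlocks_zero₂₁,
    rowNrd_fromBlocks_zero₁₂, rowNrd_one, rowNrd_one, mul_one, mul_one, mul_one, one_mul] at this
  exact ⟨_, this.trans (mul_comm _ _)⟩

/-- Let `Q'` be the image of a free module in `Q`, with relations generated by the rows of `Φ`,
and let `N` be mapped to `Q'` such that the cokernel is generated by one element `q u` on which
`G` acts trivially. Then `Fitt(N) · ⟨Nrd(g - 1)⟩` is contained in `⟨Nrd(Φ)⟩`. -/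
theorem fitt_mul_le_span_rowNrd {ι N Q : Type*} [Fintype ι] [DecidableEq ι] [AddCommGroup N]
    [Module (IwasawaAlgebra p G) N] [AddCommGroup Q] [Module (IwasawaAlgebra p G) Q]
    (q : (ι → IwasawaAlgebra p G) →ₗ[IwasawaAlgebra p G] Q)
    (f : N →ₗ[IwasawaAlgebra p G] Q) (hfq : LinearMap.range f ≤ LinearMap.range q)
    (u : ι → IwasawaAlgebra p G)
    (hu : ∀ i, q (Pi.single i 1 - u) ∈ LinearMap.range f)
    (hg : ∀ g : G, q ((grp p G g - 1) • u) ∈ LinearMap.range f)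
    (Φ : Matrix ι ι (IwasawaAlgebra p G)) (hΦ : ∀ x, q x = 0 → ∃ z, Matrix.vecMul z Φ = x) :
    fitt p G N * Ideal.span (Set.range fun g : G => NrdElt (grp p G g - 1)) ≤
      Ideal.span {rowNrd Φ} := by
  rw [fitt, Ideal.span_mul_span, Ideal.span_le]
  intro w hw
  obtain ⟨_, ⟨a, b, h, φ, hex, hsurj, c, rfl⟩, _, ⟨g, rfl⟩, rfl⟩ := Set.mem_mul.mp hw
  rw [SetLike.mem_coe, Ideal.mem_span_singleton]
  obtain ⟨y, hy⟩ := hg g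
  obtain ⟨y, rfl⟩ := hsurj y
  -- The generators of the presentation of `N`, with one more generator for the class of `u`.
  let r : ((Fin b ⊕ Fin 1) → IwasawaAlgebra p G) →ₗ[IwasawaAlgebra p G] Q :=
    (f ∘ₗ φ) ∘ₗ LinearMap.funLeft _ _ Sum.inl +
      (LinearMap.toSpanSingleton (IwasawaAlgebra p G) Q (q u)) ∘ₗ LinearMap.proj (Sum.inr 0)
  have hr : ∀ x s, r (Sum.elim x fun _ => s) = f (φ x) + s • q u := fun x s => rfl
  have hrange : LinearMap.range q = LinearMap.range r := by
    apply le_antisymm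
    · rintro _ ⟨x, rfl⟩
      rw [LinearMap.pi_apply_eq_sum_univ q x]
      refine Submodule.sum_mem _ fun i _ => Submodule.smul_mem _ _ ?_
      obtain ⟨z, hz⟩ := hu i
      obtain ⟨z, rfl⟩ := hsurj z
      -- The coefficient `1` of the extra generator accounts for `u` in `eᵢ = (eᵢ - u) + u`.
      refine ⟨Sum.elim z fun _ => 1, ?_⟩
      rw [hr, hz, map_sub, one_smul, sub_add_cancel]
      congr 1
      ext j
      simp [Pi.single_apply, eq_comm]
    · rintro _ ⟨x, rfl⟩
      exact add_mem (hfq ⟨_, rfl⟩) (Submodule.smul_mem _ _ ⟨u, rfl⟩)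
  -- The upper rows are the chosen columns of `h`. The last row is the relation `(g - 1) q(u) =
  -- f(φ(y))`. The zero block makes the reduced norm a product.
  let Ψ : Matrix (Fin b ⊕ Fin 1) (Fin b ⊕ Fin 1) (IwasawaAlgebra p G) :=
    Matrix.fromBlocks (h.submatrix id c).transpose 0 (Matrix.of fun _ => -y)
      (Matrix.of fun _ _ => grp p G g - 1)
  have hΨ : ∀ i, r (Ψ i) = 0 := by
    rintro (i | i)
    · have h1 : Ψ (Sum.inl i) = Sum.elim (colMap h (Pi.single (c i) 1)) fun _ => 0 := by
        ext (j | j)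
        · simp [Ψ, colMap]
        · simp [Ψ]
      rw [h1, hr, hex.apply_apply_eq_zero, map_zero, zero_smul, add_zero]
    · have h1 : Ψ (Sum.inr i) = Sum.elim (-y) fun _ => grp p G g - 1 := by
        ext (j | j) <;> simp [Ψ]
      rw [h1, hr, map_neg, map_neg, hy, map_smul, neg_add_cancel]
  have := rowNrd_dvd_of_range_eq q r hrange Φ hΦ Ψ hΨ
  rwa [rowNrd_fromBlocks_zero₁₂] at this

end Presentations
end NCIwasawa

namespace NCIwasawa
namespace Multigraph

/-! ### From Jacobians to the cokernel of the Laplacian -/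

section Picard

variable {V E : Type*} (X : Multigraph V E) [DecidableEq V] (p : ℕ) [Fact p.Prime]
  {H : Type*} [Group H] {S : Type*} [Ring S] [Algebra ℤ_[p] S] (γ : H →* S)

/-- The Laplacian of the derived graph of `α` over a ring `S` to which `H` is mapped by `γ`. -/
def laplacian [Fintype E] {S : Type*} [Ring S] (γ : H →* S) (α : E → H) : Matrix V V S := fun v =>
  ∑ d with X.init d = v, (Pi.single v 1 - Pi.single (X.term d) (γ (voltage α d)))

/-- The map `Div → S^V`, `(v, h) ↦ γ(h) v`. -/
noncomputable def divEval : (V × H →₀ ℤ_[p]) →ₗ[ℤ_[p]] (V → S) :=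
  Finsupp.linearCombination ℤ_[p] fun x => Pi.single x.1 (γ x.2)

theorem divEval_single (x : V × H) : divEval p γ (Finsupp.single x 1) = Pi.single x.1 (γ x.2) := by
  simp [divEval]

theorem divEval_divMap_mul (h : H) (d : V × H →₀ ℤ_[p]) :
    divEval p γ (divMap p V (h * ·) d) = γ h • divEval p γ d := by
  induction d using Finsupp.induction_linear with
  | zero => simp
  | add x y hx hy => rw [map_add, map_add, hx, hy, map_add, smul_add]
  | single x c =>
    simp only [divMap, divEval, Finsupp.lmapDomain_apply, Finsupp.mapDomain_single,
      Finsupp.linearCombination_single, Prod.map, id, map_mul]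
    rw [smul_comm, ← smul_eq_mul, Pi.single_smul]

/-- Used both for the transition maps between levels and for the projections from `G` to the levels.
-/
theorem divEval_divMap {H' : Type*} [Group H'] {S' : Type*} [Ring S'] [Algebra ℤ_[p] S']
    (γ' : H' →* S') (f : H →* H') (ρ : S →ₐ[ℤ_[p]] S') (hρ : ∀ h, ρ (γ h) = γ' (f h))
    (d : V × H →₀ ℤ_[p]) : divEval p γ' (divMap p V f d) = ρ ∘ divEval p γ d := by
  induction d using Finsupp.induction_linear with
  | zero => ext; simp
  | add x y hx hy =>
    rw [map_add, map_add, hx, hy, map_add]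
    ext
    simp
  | single x c =>
    simp only [divMap, divEval, Finsupp.lmapDomain_apply, Finsupp.mapDomain_single,
      Finsupp.linearCombination_single, Prod.map, id]
    ext v
    by_cases hv : v = x.1
    · subst hv; simp [hρ]
    · simp [hv]

variable [Fintype E]

theorem laplacian_map {H' : Type*} [Group H'] {S' : Type*} [Ring S'] (γ' : H' →* S')
    (f : H →* H') (ρ : S →+* S') (hρ : ∀ h, ρ (γ h) = γ' (f h)) (α : E → H) :
    (X.laplacian γ α).map ρ = X.laplacian γ' (fun e => f (α e)) := by
  have hv : ∀ d, f (voltage α d) = voltage (fun e => f (α e)) d := by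
    rintro (e | e) <;> simp [voltage]
  ext v w
  simp only [Matrix.map_apply, laplacian, Finset.sum_apply, map_sum, Pi.sub_apply, map_sub,
    Pi.single_apply, apply_ite ρ, map_one, map_zero, hρ, hv]

/-- Since `γ(h α(d)) = γ(h) γ(α(d))`, the common factor `γ(h)` comes out on the left. Hence
principal divisors land in the left span of the rows of the Laplacian. -/
theorem divEval_firing (α : E → H) (x : V × H) :
    divEval p γ ((X.derived α).firing p x) = γ x.2 • X.laplacian γ α x.1 := by
  have h := finsum_mem_coe_finset (fun d =>
    (Finsupp.single x 1 - Finsupp.single (X.term d, x.2 * voltage α d) 1 : V × H →₀ ℤ_[p]))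
    (Finset.univ.filter fun d => X.init d = x.1)
  simp only [Finset.coe_filter, Finset.mem_univ, true_and, Set.mem_ofPred_eq] at h
  rw [firing_derived, h, map_sum, laplacian, Finset.smul_sum]
  refine Finset.sum_congr rfl fun d _ => ?_
  rw [map_sub, divEval_single, divEval_single, smul_sub, ← Pi.single_smul, ← Pi.single_smul,
    smul_eq_mul, smul_eq_mul, mul_one, map_mul]

variable [Fintype V]

/-- The cokernel of the Laplacian over `S`. -/
abbrev Pic {S : Type*} [Ring S] (γ : H →* S) (α : E → H) : Type _ :=
  (V → S) ⧸ LinearMap.range (X.laplacian γ α).vecMulLinear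

theorem pr_le_ker_divEval (α : E → H) : (X.derived α).pr p ≤
    LinearMap.ker (((LinearMap.range (X.laplacian γ α).vecMulLinear).mkQ.restrictScalars ℤ_[p]) ∘ₗ
      divEval p γ) := by
  rw [pr, Submodule.span_le]
  rintro _ ⟨x, rfl⟩
  rw [SetLike.mem_coe, LinearMap.mem_ker, LinearMap.comp_apply, divEval_firing,
    LinearMap.restrictScalars_apply, Submodule.mkQ_apply, Submodule.Quotient.mk_eq_zero]
  refine Submodule.smul_mem _ _ ⟨Pi.single x.1 1, ?_⟩
  rw [Matrix.vecMulLinear_apply, Matrix.single_one_vecMul]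
  rfl

/-- The map from the Jacobian of the derived graph to the cokernel of the Laplacian over `S`. -/
noncomputable def jacToPic (α : E → H) : (X.derived α).Jac p →ₗ[ℤ_[p]] X.Pic γ α :=
  Submodule.liftQ _ ((((LinearMap.range (X.laplacian γ α).vecMulLinear).mkQ.restrictScalars
    ℤ_[p]) ∘ₗ divEval p γ) ∘ₗ (div0 p (V × H)).subtype)
    fun _ hy => X.pr_le_ker_divEval p γ α hy

theorem jacToPic_mk (α : E → H) (d : div0 p (V × H)) :
    X.jacToPic p γ α (Submodule.Quotient.mk d) = Submodule.Quotient.mk (divEval p γ d.1) := rfl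

theorem divEval_sub_mem_of_mk_eq (α : E → H) {d d' : div0 p (V × H)}
    (h : (Submodule.Quotient.mk d : (X.derived α).Jac p) = Submodule.Quotient.mk d') :
    divEval p γ d.1 - divEval p γ d'.1 ∈ LinearMap.range (X.laplacian γ α).vecMulLinear := by
  have h' := congrArg (X.jacToPic p γ α) h
  rwa [jacToPic_mk, jacToPic_mk, Submodule.Quotient.eq] at h'

theorem jacToPic_jacMap_mul (α : E → H) (h : H) (y : (X.derived α).Jac p) :
    X.jacToPic p γ α (X.jacMap p (h * ·) (fun _ _ => (mul_assoc _ _ _).symm) y) =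
      γ h • X.jacToPic p γ α y := by
  obtain ⟨d, rfl⟩ := Submodule.mkQ_surjective _ y
  exact congrArg Submodule.Quotient.mk (divEval_divMap_mul p γ h d.1)

theorem jacToPic_smul (α : E → H) (r : MonoidAlgebra ℤ_[p] H) (y : (X.jacRep p α).asModule) :
    X.jacToPic p γ α ((X.jacRep p α).asModuleEquiv (r • y)) =
      MonoidAlgebra.lift ℤ_[p] S H γ r •
        X.jacToPic p γ α ((X.jacRep p α).asModuleEquiv y) := by
  induction r using MonoidAlgebra.induction_linear with
  | zero => simp
  | add a b ha hb => rw [add_smul, map_add, map_add, ha, hb, map_add, add_smul]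
  | single h c =>
    simp only [Representation.asModuleEquiv_map_smul, Representation.asAlgebraHom_single,
      LinearMap.smul_apply, map_smul, MonoidAlgebra.lift_single, smul_assoc]
    congr 1
    exact X.jacToPic_jacMap_mul p γ α h _

end Picard

/-! ### The Laplacian over `Λ` and the module `Λ ⊗ J(X_∞)` -/

section Tower

variable {V E : Type*} (X : Multigraph V E) [DecidableEq V] [Fintype V] [Fintype E] (p : ℕ)
  [Fact p.Prime] {G : Type*} [Group G] [TopologicalSpace G] [IsTopologicalGroup G] (α : E → G)

/-- This explains the transpose in `D - A_αᵗ`: matrices describe maps by their columns, and the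
columns of `D - A_αᵗ` are the firing moves. -/
theorem transpose_degreeMatrix_sub :
    (X.degreeMatrix p G - (X.voltageMatrix p α).transpose).transpose =
      X.laplacian (grp p G) α := by
  refine Matrix.ext fun v w => ?_
  simp only [Matrix.transpose_apply, Matrix.sub_apply, degreeMatrix, voltageMatrix,
    Matrix.of_apply, laplacian, Finset.sum_apply, Pi.sub_apply, Finset.sum_sub_distrib]
  congr 1
  · by_cases h : v = w
    · subst h; simp
    · simp [h, Matrix.diagonal_apply_ne' _ h]
  · rw [← Finset.filter_filter, Finset.sum_filter]
    refine Finset.sum_congr rfl fun d _ => ?_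
    simp [Pi.single_apply, eq_comm]

variable [IsUniformProP p G]

/-- The common frame for both modules. The divisors `(v, 1) - (v₀, 1)` and `(v₀, g) - (v₀, 1)` have
degree zero, so the cokernel of `f` in the image of `q` is generated by `v₀` with trivial action of
`G`. -/
theorem fitt_mul_le_of_divEval_mem [Nonempty V] {N Q : Type*} [AddCommGroup N]
    [Module (IwasawaAlgebra p G) N] [AddCommGroup Q] [Module (IwasawaAlgebra p G) Q]
    (q : (V → IwasawaAlgebra p G) →ₗ[IwasawaAlgebra p G] Q)
    (f : N →ₗ[IwasawaAlgebra p G] Q) (hfq : LinearMap.range f ≤ LinearMap.range q)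
    (hf : ∀ d ∈ div0 p (V × G), q (divEval p (grp p G) d) ∈ LinearMap.range f)
    (hq : ∀ x, q x = 0 → ∃ z, Matrix.vecMul z (X.laplacian (grp p G) α) = x) :
    fitt p G N * Ideal.span (Set.range fun g : G => NrdElt (grp p G g - 1)) ≤
      Ideal.span {Nrd (X.degreeMatrix p G - (X.voltageMatrix p α).transpose)} := by
  obtain ⟨v₀⟩ := ‹Nonempty V›
  rw [← Matrix.transpose_transpose (X.degreeMatrix p G - (X.voltageMatrix p α).transpose),
    transpose_degreeMatrix_sub]
  refine fitt_mul_le_span_rowNrd q f hfq (Pi.single v₀ 1) (fun v => ?_) (fun g => ?_) _ hq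
  · have := hf (Finsupp.single (v, 1) 1 - Finsupp.single (v₀, 1) 1) (by simp [div0])
    rwa [map_sub, divEval_single, divEval_single, map_one] at this
  · have := hf (Finsupp.single (v₀, g) 1 - Finsupp.single (v₀, 1) 1) (by simp [div0])
    rwa [map_sub, divEval_single, divEval_single, map_one, ← Pi.single_sub,
      ← mul_one (grp p G g - 1), ← smul_eq_mul, Pi.single_smul] at this

/-- The map `Λ ⊗_{ℤ_p[G]} J(X_∞) → Pic`. -/
noncomputable def jacTensorToPic :
    X.JacTensor p α →ₗ[IwasawaAlgebra p G] X.Pic (grp p G) α :=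
  Submodule.liftQ _ (TensorProduct.AlgebraTensorModule.lift
    (LinearMap.toSpanSingleton (IwasawaAlgebra p G)
      (X.JacMod p α →ₗ[ℤ_[p]] X.Pic (grp p G) α)
      (X.jacToPic p (grp p G) α ∘ₗ (X.jacRep p α).asModuleEquiv.toLinearMap))) (by
    rw [Submodule.span_le]
    rintro _ ⟨x, r, y, rfl⟩
    rw [SetLike.mem_coe, LinearMap.mem_ker, map_sub, sub_eq_zero,
      TensorProduct.AlgebraTensorModule.lift_tmul, TensorProduct.AlgebraTensorModule.lift_tmul]
    have h := X.jacToPic_smul p (grp p G) α r y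
    change (x * _) • X.jacToPic p (grp p G) α ((X.jacRep p α).asModuleEquiv y) =
      x • X.jacToPic p (grp p G) α ((X.jacRep p α).asModuleEquiv (r • y))
    exact (mul_smul _ _ _).trans (congrArg (x • ·) h.symm))

theorem jacTensorToPic_mk_one_tmul (y : X.JacMod p α) :
    X.jacTensorToPic p α (Submodule.Quotient.mk (TensorProduct.tmul ℤ_[p] 1 y)) =
      X.jacToPic p (grp p G) α ((X.jacRep p α).asModuleEquiv y) :=
  one_smul (IwasawaAlgebra p G) (X.jacToPic p (grp p G) α ((X.jacRep p α).asModuleEquiv y))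

theorem fitt_jacTensor_mul_le [Nonempty V] :
    fitt p G (X.JacTensor p α) * Ideal.span (Set.range fun g : G => NrdElt (grp p G g - 1)) ≤
      Ideal.span {Nrd (X.degreeMatrix p G - (X.voltageMatrix p α).transpose)} := by
  refine X.fitt_mul_le_of_divEval_mem p α
    (LinearMap.range (X.laplacian (grp p G) α).vecMulLinear).mkQ (X.jacTensorToPic p α)
    (by rw [Submodule.range_mkQ]; exact le_top) (fun d hd => ?_) (fun x hx => ?_)
  · exact ⟨_, X.jacTensorToPic_mk_one_tmul p α
      ((X.jacRep p α).asModuleEquiv.symm (Submodule.Quotient.mk ⟨d, hd⟩))⟩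
  · rwa [Submodule.mkQ_apply, Submodule.Quotient.mk_eq_zero] at hx

/-! ### Finite levels and the inverse limit `J_∞` -/

/-- The cokernel of the Laplacian over `ℤ_p[G^{(n)}]`. -/
def PicLevel (n : ℕ) : Type _ :=
  X.Pic (MonoidAlgebra.of ℤ_[p] (Level p G n)) (levelVoltage p α n)

noncomputable instance (n : ℕ) : AddCommGroup (X.PicLevel p α n) :=
  inferInstanceAs (AddCommGroup (X.Pic _ _))

/-- `Λ` acts on the cokernel of the Laplacian over `ℤ_p[G^{(n)}]` through `πₙ`. -/
noncomputable instance (n : ℕ) : Module (IwasawaAlgebra p G) (X.PicLevel p α n) :=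
  Module.compHom (X.Pic (MonoidAlgebra.of ℤ_[p] (Level p G n)) (levelVoltage p α n)) (proj p G n)

/-- The projection `Λ^V → ∏ Picₙ`. -/
noncomputable def toPicLevels :
    (V → IwasawaAlgebra p G) →ₗ[IwasawaAlgebra p G] Π n, X.PicLevel p α n where
  toFun x n := Submodule.Quotient.mk (proj p G n ∘ x)
  map_add' x y := funext fun n =>
    (congrArg Submodule.Quotient.mk (funext fun v => map_add (proj p G n) (x v) (y v))).trans
      (Submodule.Quotient.mk_add _)
  map_smul' a x := funext fun n =>
    (congrArg Submodule.Quotient.mk (funext fun v => map_mul (proj p G n) a (x v))).trans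
      (Submodule.Quotient.mk_smul _ (r := proj p G n a) (x := proj p G n ∘ x))

/-- The map `J_∞ → ∏ Picₙ`. -/
noncomputable def jacLimToPicLevels :
    X.jacLim p α →ₗ[IwasawaAlgebra p G] Π n, X.PicLevel p α n where
  toFun y n := X.jacToPic p (MonoidAlgebra.of ℤ_[p] (Level p G n)) (levelVoltage p α n) (y.1 n)
  map_add' x y := funext fun n => map_add (X.jacToPic p _ _) _ _
  map_smul' a y := funext fun n => by
    have h := X.jacToPic_smul p (MonoidAlgebra.of ℤ_[p] (Level p G n)) (levelVoltage p α n)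
      (proj p G n a) (y.1 n)
    -- At level `n` the scalars are already in `ℤ_p[G^{(n)}]`, so the extension of the inclusion of
    -- the group to the group ring is the identity.
    have hid : MonoidAlgebra.lift ℤ_[p] _ _ (MonoidAlgebra.of ℤ_[p] (Level p G n)) =
        AlgHom.id ℤ_[p] _ := by
      ext; simp
    rw [hid] at h
    exact h

/-- The projection `ℤ_p[G^{(n+1)}] → ℤ_p[G^{(n)}]`. -/
noncomputable def levelAlgHom (G : Type*) [Group G] [TopologicalSpace G] [IsTopologicalGroup G]
    (n : ℕ) :
    MonoidAlgebra ℤ_[p] (Level p G (n + 1)) →ₐ[ℤ_[p]] MonoidAlgebra ℤ_[p] (Level p G n) :=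
  MonoidAlgebra.mapDomainAlgHom ℤ_[p] ℤ_[p] (levelMap p G n)

theorem levelAlgHom_of (n : ℕ) (h : Level p G (n + 1)) :
    levelAlgHom p G n (MonoidAlgebra.of ℤ_[p] _ h) =
      MonoidAlgebra.of ℤ_[p] _ (levelMap p G n h) := by
  simp [levelAlgHom]

/-- The projection `ℤ_p[G^{(n+1)}]^V → ℤ_p[G^{(n)}]^V`. -/
noncomputable def vecTrans (V G : Type*) [Group G] [TopologicalSpace G] [IsTopologicalGroup G]
    (n : ℕ) :
    (V → MonoidAlgebra ℤ_[p] (Level p G (n + 1))) →ₗ[ℤ_[p]]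
      (V → MonoidAlgebra ℤ_[p] (Level p G n)) :=
  (levelAlgHom p G n).toLinearMap.compLeft V

/-- The vector over `Λ` with given compatible components. -/
noncomputable def limVec (z : ∀ n, V → MonoidAlgebra ℤ_[p] (Level p G n))
    (hz : ∀ n, vecTrans p V G n (z (n + 1)) = z n) (v : V) : IwasawaAlgebra p G :=
  ⟨fun n => z n v, fun n => congrFun (hz n) v⟩

/-- The Laplacian at level `n`. -/
noncomputable def levelLaplacian (n : ℕ) : Matrix V V (MonoidAlgebra ℤ_[p] (Level p G n)) :=
  X.laplacian (MonoidAlgebra.of ℤ_[p] (Level p G n)) (levelVoltage p α n)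

theorem laplacian_map_proj (n : ℕ) :
    (X.laplacian (grp p G) α).map (proj p G n) = X.levelLaplacian p α n :=
  X.laplacian_map (grp p G) (MonoidAlgebra.of ℤ_[p] (Level p G n))
    (QuotientGroup.mk' (powSubgroup p G n)) (proj p G n) (fun _ => rfl) α

theorem levelLaplacian_map (n : ℕ) :
    (X.levelLaplacian p α (n + 1)).map (levelAlgHom p G n) = X.levelLaplacian p α n :=
  X.laplacian_map (MonoidAlgebra.of ℤ_[p] (Level p G (n + 1)))
    (MonoidAlgebra.of ℤ_[p] (Level p G n)) (levelMap p G n) (levelAlgHom p G n).toRingHom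
    (levelAlgHom_of p n) (levelVoltage p α (n + 1))

theorem vecTrans_vecMul (n : ℕ) (z : V → MonoidAlgebra ℤ_[p] (Level p G (n + 1))) :
    vecTrans p V G n (Matrix.vecMul z (X.levelLaplacian p α (n + 1))) =
      Matrix.vecMul (vecTrans p V G n z) (X.levelLaplacian p α n) := by
  rw [← X.levelLaplacian_map p α n]
  refine funext fun v => (map_sum (levelAlgHom p G n) _ _).trans ?_
  exact Finset.sum_congr rfl fun w _ => map_mul (levelAlgHom p G n) _ _

/-- At each level the solutions of `z Lₙ = xₙ` form a coset of the left kernel of `Lₙ`, and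
transition maps send solutions to solutions. Compactness yields a compatible system, which is a
solution over `Λ`. -/
theorem exists_vecMul_of_toPicLevels_eq_zero (x : V → IwasawaAlgebra p G)
    (hx : X.toPicLevels p α x = 0) :
    ∃ z, Matrix.vecMul z (X.laplacian (grp p G) α) = x := by
  have h0 : ∀ n, ∃ z, Matrix.vecMul z (X.levelLaplacian p α n) = proj p G n ∘ x := fun n =>
    (Submodule.Quotient.mk_eq_zero _).mp (congrFun hx n)
  choose y hy using h0
  have htx : ∀ n, vecTrans p V G n (proj p G (n + 1) ∘ x) = proj p G n ∘ x := fun n =>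
    funext fun v => proj_succ p G n (x v)
  obtain ⟨z, hz, hzt⟩ := exists_compatible_of_sub_mem (vecTrans p V G)
    (fun n => (LinearMap.ker (X.levelLaplacian p α n).vecMulLinear).restrictScalars ℤ_[p])
    (fun n w hw => by
      change Matrix.vecMul w _ = 0 at hw
      change Matrix.vecMul _ _ = 0
      rw [← vecTrans_vecMul, hw, map_zero]) y (fun n => by
      change Matrix.vecMul _ _ = 0
      rw [Matrix.sub_vecMul, ← vecTrans_vecMul, hy, hy, htx, sub_self])
  refine ⟨limVec p z hzt, funext fun v => Subtype.ext (funext fun n => ?_)⟩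
  have h1 : Matrix.vecMul (z n) (X.levelLaplacian p α n) = proj p G n ∘ x := by
    have := hz n
    change Matrix.vecMul _ _ = 0 at this
    rwa [Matrix.sub_vecMul, hy, sub_eq_zero] at this
  have h2 := RingHom.map_vecMul (proj p G n) (X.laplacian (grp p G) α) (limVec p z hzt) v
  rw [laplacian_map_proj] at h2
  exact h2.trans (congrFun h1 v)

theorem vecTrans_divEval_sub_mem (n : ℕ) (d : div0 p (V × Level p G (n + 1)))
    (d' : div0 p (V × Level p G n))
    (h : X.jacMap p (α := levelVoltage p α (n + 1)) (β := levelVoltage p α n) (levelMap p G n)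
      (fun _ _ => map_mul _ _ _) (Submodule.Quotient.mk d) = Submodule.Quotient.mk d') :
    vecTrans p V G n (divEval p (MonoidAlgebra.of ℤ_[p] (Level p G (n + 1))) d.1) -
      divEval p (MonoidAlgebra.of ℤ_[p] (Level p G n)) d'.1 ∈
        LinearMap.range (X.levelLaplacian p α n).vecMulLinear := by
  have h1 : divEval p (MonoidAlgebra.of ℤ_[p] (Level p G n))
      (divMap p V (levelMap p G n) d.1) =
      vecTrans p V G n (divEval p (MonoidAlgebra.of ℤ_[p] (Level p G (n + 1))) d.1) :=
    divEval_divMap p _ _ (levelMap p G n) (levelAlgHom p G n) (levelAlgHom_of p n) d.1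
  rw [← h1]
  exact X.divEval_sub_mem_of_mk_eq p _ (levelVoltage p α n)
    (d := ⟨divMap p V (levelMap p G n) d.1, divMap_mem_div0 p _ d.1 d.2⟩) h

/-- Divisors representing the components of an element of `J_∞` are compatible only up to principal
ones, so their vectors are compatible up to the row spaces. Compactness allows a correction within
these row spaces to an honest vector over `Λ`. -/
theorem range_jacLimToPicLevels_le :
    LinearMap.range (X.jacLimToPicLevels p α) ≤ LinearMap.range (X.toPicLevels p α) := by
  rintro _ ⟨y, rfl⟩
  have h0 : ∀ n, ∃ d : div0 p (V × Level p G n), (Submodule.Quotient.mk d :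
      (X.derived (levelVoltage p α n)).Jac p) = y.1 n := fun n =>
    Submodule.mkQ_surjective _ _
  choose d hd using h0
  obtain ⟨z, hz, hzt⟩ := exists_compatible_of_sub_mem (vecTrans p V G)
    (fun n => (LinearMap.range (X.levelLaplacian p α n).vecMulLinear).restrictScalars ℤ_[p])
    (fun n w hw => by
      obtain ⟨w, rfl⟩ := hw
      exact ⟨vecTrans p V G n w, (X.vecTrans_vecMul p α n w).symm⟩)
    (fun n => divEval p (MonoidAlgebra.of ℤ_[p] (Level p G n)) (d n).1) (fun n => by
      exact X.vecTrans_divEval_sub_mem p α n (d (n + 1)) (d n) (by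
        rw [hd, hd]
        exact y.2 n))
  refine ⟨limVec p z hzt, funext fun n => ?_⟩
  change _ = X.jacToPic p (MonoidAlgebra.of ℤ_[p] (Level p G n)) (levelVoltage p α n) (y.1 n)
  rw [← hd n]
  exact (Submodule.Quotient.eq _).mpr (hz n)

/-- A degree-zero divisor on `X_∞` pushes forward to all `Xₙ` and so defines an element of `J_∞`
with the required image. -/
theorem toPicLevels_divEval_mem (d : V × G →₀ ℤ_[p]) (hd : d ∈ div0 p (V × G)) :
    X.toPicLevels p α (divEval p (grp p G) d) ∈ LinearMap.range (X.jacLimToPicLevels p α) := by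
  let y : ∀ n, X.JacLevel p α n := fun n => (Submodule.Quotient.mk
    ⟨divMap p V (QuotientGroup.mk : G → Level p G n) d, divMap_mem_div0 p _ d hd⟩ :
      (X.derived (levelVoltage p α n)).Jac p)
  have hy : y ∈ X.jacLim p α := fun n => by
    refine congrArg (Submodule.mkQ _) (Subtype.ext ?_)
    change divMap p V (levelMap p G n) (divMap p V _ d) = divMap p V _ d
    simp only [divMap, Finsupp.lmapDomain_apply, ← Finsupp.mapDomain_comp]
    rfl
  refine ⟨⟨y, hy⟩, funext fun n => ?_⟩
  let ρ : IwasawaAlgebra p G →ₐ[ℤ_[p]] MonoidAlgebra ℤ_[p] (Level p G n) :=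
    { proj p G n with commutes' := fun _ => rfl }
  exact congrArg Submodule.Quotient.mk (divEval_divMap p (grp p G)
    (MonoidAlgebra.of ℤ_[p] (Level p G n)) (QuotientGroup.mk' (powSubgroup p G n)) ρ
    (fun _ => rfl) d)

theorem fitt_jacLim_mul_le [Nonempty V] :
    fitt p G (X.jacLim p α) * Ideal.span (Set.range fun g : G => NrdElt (grp p G g - 1)) ≤
      Ideal.span {Nrd (X.degreeMatrix p G - (X.voltageMatrix p α).transpose)} :=
  X.fitt_mul_le_of_divEval_mem p α (X.toPicLevels p α) (X.jacLimToPicLevels p α)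
    (X.range_jacLimToPicLevels_le p α) (X.toPicLevels_divEval_mem p α)
    (X.exists_vecMul_of_toPicLevels_eq_zero p α)

end Tower
end Multigraph
end NCIwasawa

theorem lemma6p5 (p : ℕ) [Fact p.Prime]
    {G : Type*} [Group G] [TopologicalSpace G] [IsTopologicalGroup G]
    [NCIwasawa.IsUniformProP p G]
    {V E : Type*} [Fintype V] [DecidableEq V] [Fintype E]
    (X : NCIwasawa.Multigraph V E) (α : E → G)
    (hX : ∀ n, (X.derived (NCIwasawa.Multigraph.levelVoltage p α n)).Connected) :
    NCIwasawa.fitt p G (X.jacLim p α) *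
        Ideal.span (Set.range fun g : G => NCIwasawa.NrdElt (NCIwasawa.grp p G g - 1)) ≤
      Ideal.span {NCIwasawa.Nrd (X.degreeMatrix p G - (X.voltageMatrix p α).transpose)} ∧
    NCIwasawa.fitt p G (X.JacTensor p α) *
        Ideal.span (Set.range fun g : G => NCIwasawa.NrdElt (NCIwasawa.grp p G g - 1)) ≤
      Ideal.span {NCIwasawa.Nrd (X.degreeMatrix p G - (X.voltageMatrix p α).transpose)} := by
  -- Connectedness of `X₀` includes the existence of a vertex, which supplies the base point `v₀`.
  have : Nonempty V := (hX 0).nonempty.map Prod.fst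
  exact ⟨X.fitt_jacLim_mul_le p α, X.fitt_jacTensor_mul_le p α⟩
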